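/- **Proposition 3.5.** Let $\mathcal A$ be a finite alphabet, and let $\mathbb P,\mathbb Q$ be probability measures on $\mathcal A^{\mathbb N}$ (sequences $x=(x_k)_{k\ge1}$) that are invariant under the left shift $T$. Write $x_m^n=x_m x_{m+1}\cdots x_n$, let $\mathbb P[a]$ be the probability that a sequence starts with the word $a$ (so $\mathbb P[\text{empty word}]=1$), and put $\operatorname{supp}\mathbb P_n=\{a\in\mathcal A^n:\mathbb P[a]>0\}$ and $\operatorname{supp}\mathbb P=\{x:\mathbb P[x_1^n]>0\text{ for all }n\}$; similarly for $\mathbb Q$. Let $$\bar q(\alpha)=\limsup_{n\to\infty}\frac1n\ln\sum_{a\in\operatorname{supp}\mathbb P_n}\mathbb P[a]^{-\alpha}\,\mathbb Q[a]\in[-\infty,\infty],\qquad\alpha\in\mathbb R.$$ Assume that $\operatorname{supp}\mathbb Q\subseteq\operatorname{supp}\mathbb P$ and that the following hold. - (SLD for $\mathbb P$) There are sequences $k_n\in[0,\infty)$ and $\tau_n\in\{0,1,2,\dots\}$, both $o(n)$, such that for all $n,m\ge1$, $a\in\operatorname{supp}\mathbb P_n$ and $b\in\operatorname{supp}\mathbb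 P_m$ there are $0\le\ell\le\tau_n$ and $\xi\in\operatorname{supp}\mathbb P_\ell$ with $\mathbb P[a\xi b]\ge e^{-k_n}\mathbb P[a]\mathbb P[b]$. - (SE for $\mathbb P$) There are $\beta\ge1$ and $\gamma_-<0$ such that $\mathbb P[a]\ge e^{\gamma_- n^\beta}$ for all $n\ge1$ and $a\in\operatorname{supp}\mathbb P_n$. - (UD for $\mathbb Q$) There are sequences $k_n\in[0,\infty)$ and $\tau_n\in\{0,1,2,\dots\}$, both $o(n)$, such that $\mathbb Q[a\xi b]\le e^{k_n}\mathbb Q[a]\mathbb Q[b]$ for all $n,m\ge1$, $a\in\operatorname{supp}\mathbb Q_n$, $\xi\in\operatorname{supp}\mathbb Q_{\tau_n}$ and $b\in\operatorname{supp}\mathbb Q_m$. - (ND) $\bar q(-1)<0$. For sequences $x,y$ and $N,\ell\ge1$ let $W_\ell(y,x)=\inf\{r\ge1:x_r^{r+\ell-1}=y_1^\ell\}$ (with $\inf\emptyset=\infty$) and $\Lambda_N(y,x)=\max\{1,\sup\{\ell\ge1:W_\ell(y,x)\le N-\ell+1\}\}$ (the supremum being omitted if the set is empty). Parse $y_1^N$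 with respect to $x_1^N$ as follows: $L_0=0$, and as long as $L_i<N$, put $L_{i+1}=\min\{N,\,L_i+\Lambda_N(T^{L_i}y,x)+1\}$ and $\overline w^{(i+1,N)}=y_{L_i+1}^{L_{i+1}}$. Let $c_N=c_N(y|x)$ be the number of words obtained, and let $\underline w^{(i,N)}$ be $\overline w^{(i,N)}$ without its last letter. Then the one-sided derivatives $D_-\bar q(0)$ and $D_+\bar q(0)$ exist in $[-\infty,\infty]$ and, for $(\mathbb P\otimes\mathbb Q)$-almost every $(x,y)$, $$\liminf_{N\to\infty}\frac1{N-c_N}\sum_{i=1}^{c_N}-\ln\mathbb P[\underline w^{(i,N)}]\ \ge\ D_-\bar q(0) \qquad\text{and}\qquad \limsup_{N\to\infty}\frac1N\sum_{i=1}^{c_N-1}-\ln\mathbb P[\overline w^{(i,N)}]\ \le\ D_+\bar q(0).$$ -/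

import Mathlib

open MeasureTheory Filter Topology Asymptotics

namespace ZivMerhav

noncomputable section

/-! Sequences `x₁ x₂ x₃ …` over the alphabet `A` are functions `x : ℕ → A`, with `x k` standing
for the letter `x_{k+1}`. Finite words are lists of letters. -/

/-- The left shift `T`. -/
def shift {A : Type*} (x : ℕ → A) : ℕ → A := fun k => x (k + 1)

/-- The word of length `l` read in `x` after skipping the first `s` letters, `x_{s+1}^{s+l}`. -/
def word {A : Type*} (x : ℕ → A) (s l : ℕ) : List A := (List.range l).map fun i => x (s + i)

/-- The basic cylinder `[a]`. -/
def wordCylinder {A : Type*} (a : List A) : Set (ℕ → A) := {x | word x 0 a.length = a}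

/-- The probability `μ[a]` of the cylinder of `a`. It is `1` for the empty word when `μ` is a
probability measure. -/
def cylProb {A : Type*} [MeasurableSpace A] (μ : Measure (ℕ → A)) (a : List A) : ℝ :=
  μ.real (wordCylinder a)

/-- `supp μ_n`: the words of length `n` with positive probability. -/
def wordSupport {A : Type*} [MeasurableSpace A] (μ : Measure (ℕ → A)) (n : ℕ) : Set (List A) :=
  {a | a.length = n ∧ 0 < cylProb μ a}

/-- `supp μ`: the sequences all of whose prefixes have positive probability. -/
def seqSupport {A : Type*} [MeasurableSpace A] (μ : Measure (ℕ → A)) : Set (ℕ → A) :=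
  {x | ∀ n : ℕ, 0 < cylProb μ (word x 0 n)}

/-- A pair of `o(n)`-sequences, one with values in `[0, ∞)` and one with values in `ℕ₀`. -/
def SublinearPair (k : ℕ → ℝ) (τ : ℕ → ℕ) : Prop :=
  (∀ n, 0 ≤ k n) ∧ (k =o[atTop] fun n : ℕ => (n : ℝ)) ∧
    ((fun n => (τ n : ℝ)) =o[atTop] fun n : ℕ => (n : ℝ))

/-- Upper decoupling (UD). -/
def UpperDecoupled {A : Type*} [MeasurableSpace A] (μ : Measure (ℕ → A)) : Prop :=
  ∃ (k : ℕ → ℝ) (τ : ℕ → ℕ), SublinearPair k τ ∧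
    ∀ n : ℕ, 1 ≤ n → ∀ a ∈ wordSupport μ n, ∀ ξ ∈ wordSupport μ (τ n),
      ∀ m : ℕ, 1 ≤ m → ∀ b ∈ wordSupport μ m,
        cylProb μ (a ++ ξ ++ b) ≤ Real.exp (k n) * (cylProb μ a * cylProb μ b)

/-- Selective lower decoupling (SLD). -/
def SelectivelyLowerDecoupled {A : Type*} [MeasurableSpace A] (μ : Measure (ℕ → A)) : Prop :=
  ∃ (k : ℕ → ℝ) (τ : ℕ → ℕ), SublinearPair k τ ∧
    ∀ n : ℕ, 1 ≤ n → ∀ a ∈ wordSupport μ n, ∀ m : ℕ, 1 ≤ m → ∀ b ∈ wordSupport μ m,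
      ∃ l : ℕ, l ≤ τ n ∧ ∃ ξ ∈ wordSupport μ l,
        Real.exp (-k n) * (cylProb μ a * cylProb μ b) ≤ cylProb μ (a ++ ξ ++ b)

/-- Slow enough decay (SE). -/
def DecaysSlowlyEnough {A : Type*} [MeasurableSpace A] (μ : Measure (ℕ → A)) : Prop :=
  ∃ (β γ : ℝ), 1 ≤ β ∧ γ < 0 ∧
    ∀ n : ℕ, 1 ≤ n → ∀ a ∈ wordSupport μ n, Real.exp (γ * (n : ℝ) ^ β) ≤ cylProb μ a

/-- The sum of `P[a]^{-α} Q[a]` over the words `a` of length `n` with `P[a] > 0`. It is positive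
as soon as the support of `Q` is contained in that of `P`. -/
def pressureSum {A : Type*} [Fintype A] [MeasurableSpace A] (P Q : Measure (ℕ → A))
    (α : ℝ) (n : ℕ) : ℝ :=
  ∑ v : Fin n → A with 0 < cylProb P (List.ofFn v),
    cylProb P (List.ofFn v) ^ (-α) * cylProb Q (List.ofFn v)

/-- The cross-entropic pressure, with values in `[-∞, ∞]`. -/
def pressure {A : Type*} [Fintype A] [MeasurableSpace A] (P Q : Measure (ℕ → A))
    (α : ℝ) : EReal :=
  limsup (fun n : ℕ => ((1 / (n : ℝ) * Real.log (pressureSum P Q α n) : ℝ) : EReal)) atTop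

/-- Nondegeneracy (ND). -/
def Nondegenerate {A : Type*} [Fintype A] [MeasurableSpace A] (P Q : Measure (ℕ → A)) : Prop :=
  pressure P Q (-1) < 0

/-- The left derivative of `f` at `t` exists in `[-∞, ∞]` and equals `D`
(meant for functions that are finite at `t`). -/
def HasLeftDeriv (f : ℝ → EReal) (t : ℝ) (D : EReal) : Prop :=
  Tendsto (fun α : ℝ => (f α - f t) / ((α - t : ℝ) : EReal)) (𝓝[<] t) (𝓝 D)

/-- The right derivative of `f` at `t` exists in `[-∞, ∞]` and equals `D`
(meant for functions that are finite at `t`). -/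
def HasRightDeriv (f : ℝ → EReal) (t : ℝ) (D : EReal) : Prop :=
  Tendsto (fun α : ℝ => (f α - f t) / ((α - t : ℝ) : EReal)) (𝓝[>] t) (𝓝 D)

/-- The waiting time `W_l(y, x) = inf {r ≥ 1 : x_r^{r+l-1} = y_1^l}`, with `inf ∅ = ∞`. -/
def waitingTime {A : Type*} (l : ℕ) (y x : ℕ → A) : ℕ∞ :=
  sInf {w : ℕ∞ | ∃ r : ℕ, 1 ≤ r ∧ word x (r - 1) l = word y 0 l ∧ w = (r : ℕ∞)}

/-- The match length `Λ_N(y, x) = max {1, sup {l ≥ 1 : W_l(y, x) ≤ N - l + 1}}`. The inequality is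
written without subtraction; since waiting times are at least `1`, it forces `l ≤ N`. -/
def matchLength {A : Type*} (N : ℕ) (y x : ℕ → A) : ℕ :=
  max 1 (sSup {l : ℕ | 1 ≤ l ∧ waitingTime l y x + (l : ℕ∞) ≤ (N : ℕ∞) + 1})

/-- The total length `L_{i,N}` of the first `i` words of the modified Ziv–Merhav parsing of `y_1^N`
with respect to `x_1^N`. Once it reaches `N`, the procedure is over and the value stays at `N`. -/
def parseEnd {A : Type*} (N : ℕ) (y x : ℕ → A) : ℕ → ℕ
  | 0 => 0
  | i + 1 => min N (parseEnd N y x i + matchLength N (shift^[parseEnd N y x i] y) x + 1)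

/-- The number `c_N(y|x)` of words in the parsing. -/
def parseCount {A : Type*} (N : ℕ) (y x : ℕ → A) : ℕ := sInf {i : ℕ | parseEnd N y x i = N}

/-- The word with number `i + 1` of the parsing, for `i < c_N(y|x)`. -/
def parsedWord {A : Type*} (N : ℕ) (y x : ℕ → A) (i : ℕ) : List A :=
  word y (parseEnd N y x i) (parseEnd N y x (i + 1) - parseEnd N y x i)

/-- The word with number `i + 1` of the parsing, without its last letter. -/
def trimmedWord {A : Type*} (N : ℕ) (y x : ℕ → A) (i : ℕ) : List A :=
  (parsedWord N y x i).dropLast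

end

end ZivMerhav

/-!
The pressure at `α` is the exponential growth rate of the moment of order `-α` of `P[y₁ … yₙ]`
under `Q`. Weight a word `a` of length `n` by `P[a] ^ (-α) * exp (-r n)` with `r` above the pressure
at `α`: the weights then have exponentially small expectation. Summing the products of weights over
all families of subwords separated by sufficient gaps gives a sum that satisfies a renewal
inequality by upper decoupling, so it grows subexponentially, and Borel–Cantelli bounds
`α * ∑ -log P` over every separated family of subwords of `y₁ … y_N` simultaneously. Since a
parsing of `y` is a particular family, no control of the dependence between `x` and its words is
needed.

For `α < 0` this bounds `∑ -log P` from below: each word of the parsing is long, because every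
fixed word occurs in `x`, and is shortened slightly to make room for its own gap. For `α > 0` it
bounds `∑ -log P` from above: taking every second word, the word in between serves as the gap. The
words followed by one too short for this are negligible: probable words occur early in `x` by
selective lower decoupling, so a short word starts where an improbable word is read, which happens
rarely, while nondegeneracy makes all matches logarithmically short. The slopes of the pressure at
`0` are monotone by Jensen's inequality, so letting `α → 0` gives the one-sided derivatives.
-/

namespace ZivMerhav

section Words

variable {A : Type*}

@[simp] lemma length_word (x : ℕ → A) (s l : ℕ) : (word x s l).length = l := by simp [word]

@[simp] lemma word_zero (x : ℕ → A) (s : ℕ) : word x s 0 = [] := rfl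

@[simp] lemma shift_iterate_apply (x : ℕ → A) (p k : ℕ) : shift^[p] x k = x (p + k) := by
  induction p generalizing x with
  | zero => simp
  | succ p ih => rw [Function.iterate_succ_apply, ih, shift, Nat.add_right_comm]

lemma word_shift_iterate (x : ℕ → A) (p s l : ℕ) : word (shift^[p] x) s l = word x (p + s) l := by
  simp [word, Nat.add_assoc]

lemma word_eq_word_iff {x y : ℕ → A} {s t l : ℕ} :
    word x s l = word y t l ↔ ∀ i < l, x (s + i) = y (t + i) := by
  simp [word]

lemma word_eq_ofFn (x : ℕ → A) (s l : ℕ) :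
    word x s l = List.ofFn fun i : Fin l => x (s + i) := by
  apply List.ext_getElem <;> simp [word]

lemma word_add (x : ℕ → A) (s a b : ℕ) : word x s (a + b) = word x s a ++ word x (s + a) b := by
  simp [word, List.range_add, Nat.add_assoc]

lemma word_succ (x : ℕ → A) (s l : ℕ) : word x s (l + 1) = x s :: word x (s + 1) l := by
  rw [Nat.add_comm, word_add]
  rfl

lemma take_word (x : ℕ → A) (s : ℕ) {k l : ℕ} (h : k ≤ l) :
    (word x s l).take k = word x s k := by
  obtain ⟨d, rfl⟩ := Nat.exists_eq_add_of_le h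
  rw [word_add, List.take_left' (length_word x s k)]

lemma drop_word (x : ℕ → A) (s k l : ℕ) : (word x s l).drop k = word x (s + k) (l - k) := by
  rcases le_total k l with h | h
  · obtain ⟨d, rfl⟩ := Nat.exists_eq_add_of_le h
    rw [word_add, List.drop_left' (length_word x s k), Nat.add_sub_cancel_left]
  · rw [List.drop_of_length_le (by simpa using h), Nat.sub_eq_zero_of_le h, word_zero]

lemma dropLast_word (x : ℕ → A) (s l : ℕ) : (word x s l).dropLast = word x s (l - 1) := by
  rw [List.dropLast_eq_take, length_word, take_word x s (Nat.sub_le l 1)]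

lemma word_eq_append_iff {x : ℕ → A} {s : ℕ} {a b : List A} :
    word x s (a ++ b).length = a ++ b ↔
      word x s a.length = a ∧ word x (s + a.length) b.length = b := by
  rw [List.length_append, word_add]
  exact ⟨fun h => List.append_inj h (length_word x s _), fun ⟨ha, hb⟩ => by rw [ha, hb]⟩

lemma mem_wordCylinder_iff {a : List A} {x : ℕ → A} :
    x ∈ wordCylinder a ↔ word x 0 a.length = a :=
  Iff.rfl

lemma shift_iterate_mem_wordCylinder {a : List A} {x : ℕ → A} {s : ℕ} :
    shift^[s] x ∈ wordCylinder a ↔ word x s a.length = a := by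
  rw [mem_wordCylinder_iff, word_shift_iterate, Nat.add_zero]

end Words

section Measurability

variable {A : Type*} [MeasurableSpace A]

lemma measurable_window (s l : ℕ) : Measurable fun (y : ℕ → A) (i : Fin l) => y (s + i) :=
  measurable_pi_lambda _ fun i => measurable_pi_apply (s + i : ℕ)

variable [Countable A] [MeasurableSingletonClass A]

lemma measurable_word_comp {β : Type*} [MeasurableSpace β] (F : List A → β) (s l : ℕ) :
    Measurable fun y : ℕ → A => F (word y s l) := by
  simp only [word_eq_ofFn]
  exact (Measurable.of_discrete (f := fun v : Fin l → A => F (List.ofFn v))).comp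
    (measurable_window s l)

lemma measurableSet_word_eq (s l : ℕ) (a : List A) : MeasurableSet {y : ℕ → A | word y s l = a} :=
  measurableSet_setOfPred.2 (measurable_word_comp (fun b => b = a) s l)

lemma measurableSet_wordCylinder (a : List A) : MeasurableSet (wordCylinder a) :=
  measurableSet_word_eq 0 a.length a

end Measurability

section Cylinders

variable {A : Type*} [MeasurableSpace A]

lemma cylProb_nonneg (μ : Measure (ℕ → A)) (a : List A) : 0 ≤ cylProb μ a := measureReal_nonneg

lemma ofReal_cylProb (μ : Measure (ℕ → A)) [IsFiniteMeasure μ] (a : List A) :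
    ENNReal.ofReal (cylProb μ a) = μ (wordCylinder a) :=
  ofReal_measureReal

lemma cylProb_le_one (μ : Measure (ℕ → A)) [IsProbabilityMeasure μ] (a : List A) :
    cylProb μ a ≤ 1 :=
  measureReal_le_one

@[simp] lemma cylProb_nil (μ : Measure (ℕ → A)) [IsProbabilityMeasure μ] : cylProb μ [] = 1 := by
  simp [cylProb, wordCylinder]

lemma cylProb_append_le_left (μ : Measure (ℕ → A)) [IsFiniteMeasure μ] (a b : List A) :
    cylProb μ (a ++ b) ≤ cylProb μ a :=
  measureReal_mono fun _ hx => (word_eq_append_iff.1 hx).1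

lemma cylProb_word_anti (μ : Measure (ℕ → A)) [IsFiniteMeasure μ] (x : ℕ → A) (s : ℕ) {l l' : ℕ}
    (h : l ≤ l') : cylProb μ (word x s l') ≤ cylProb μ (word x s l) := by
  obtain ⟨d, rfl⟩ := Nat.exists_eq_add_of_le h
  rw [word_add]
  exact cylProb_append_le_left μ _ _

lemma ae_mem_seqSupport [Countable A] (μ : Measure (ℕ → A)) [IsFiniteMeasure μ] :
    ∀ᵐ y ∂μ, y ∈ seqSupport μ := by
  have h : ∀ a : List A, ∀ᵐ y ∂μ, y ∈ wordCylinder a → 0 < cylProb μ a := fun a => by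
    rcases (cylProb_nonneg μ a).eq_or_lt with ha | ha
    · have h0 : μ (wordCylinder a) = 0 := by rw [← ofReal_cylProb, ← ha, ENNReal.ofReal_zero]
      filter_upwards [measure_eq_zero_iff_ae_notMem.1 h0] with y hy h using absurd h hy
    · exact Eventually.of_forall fun _ _ => ha
  filter_upwards [ae_all_iff.2 h] with y hy n using hy _ (by simp [wordCylinder])

lemma cylProb_pos_of_seqSupport_subset [Countable A] {P Q : Measure (ℕ → A)} [IsFiniteMeasure Q]
    (hPQ : seqSupport Q ⊆ seqSupport P) {a : List A} (ha : 0 < cylProb Q a) : 0 < cylProb P a := by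
  obtain ⟨y, hya, hy⟩ : ∃ y ∈ wordCylinder a, y ∈ seqSupport Q := by
    by_contra! h
    have h0 : Q (wordCylinder a) = 0 := measure_mono_null h (ae_iff.1 (ae_mem_seqSupport Q))
    simp [cylProb, measureReal_def, h0] at ha
  have hpos := hPQ hy a.length
  rwa [mem_wordCylinder_iff.1 hya] at hpos

section Stationary

variable [Countable A] [MeasurableSingletonClass A] {μ : Measure (ℕ → A)}

lemma lintegral_word_eq (hμ : MeasurePreserving shift μ μ) (F : List A → ENNReal) (s l : ℕ) :
    ∫⁻ y, F (word y s l) ∂μ = ∫⁻ y, F (word y 0 l) ∂μ := by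
  rw [← (hμ.iterate s).lintegral_comp (measurable_word_comp F 0 l)]
  simp only [word_shift_iterate, Nat.add_zero]

lemma measure_word_eq (hμ : MeasurePreserving shift μ μ) (s : ℕ) (a : List A) :
    μ {y | word y s a.length = a} = μ (wordCylinder a) := by
  rw [← (hμ.iterate s).measure_preimage (measurableSet_wordCylinder a).nullMeasurableSet]
  congr 1
  ext y
  exact shift_iterate_mem_wordCylinder.symm

lemma cylProb_append_le_right [IsFiniteMeasure μ] (hμ : MeasurePreserving shift μ μ)
    (a b : List A) : cylProb μ (a ++ b) ≤ cylProb μ b := by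
  rw [cylProb, cylProb, measureReal_def, measureReal_def, ← measure_word_eq hμ a.length b]
  exact ENNReal.toReal_mono (measure_ne_top _ _) (measure_mono fun x hx => by
    simpa using (word_eq_append_iff.1 hx).2)

lemma ae_cylProb_word_pos [IsFiniteMeasure μ] (hμ : MeasurePreserving shift μ μ)
    {P : Measure (ℕ → A)} (hP : ∀ a, 0 < cylProb μ a → 0 < cylProb P a) :
    ∀ᵐ y ∂μ, ∀ s l, 0 < cylProb P (word y s l) := by
  filter_upwards [ae_mem_seqSupport μ] with y hy s l
  have h := hy (s + l)
  rw [word_add, Nat.zero_add] at h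
  exact hP _ (h.trans_le (cylProb_append_le_right hμ _ _))

end Stationary

lemma lintegral_comp_eq_sum {Ω α : Type*} [MeasurableSpace Ω] [MeasurableSpace α] [Fintype α]
    [MeasurableSingletonClass α] {μ : Measure Ω} {X : Ω → α} (hX : Measurable X)
    (F : α → ENNReal) : ∫⁻ ω, F (X ω) ∂μ = ∑ v, F v * μ (X ⁻¹' {v}) := by
  rw [← lintegral_map Measurable.of_discrete hX, lintegral_fintype]
  simp only [Measure.map_apply hX (measurableSet_singleton _)]

lemma lintegral_initialWord [Fintype A] [MeasurableSingletonClass A] (μ : Measure (ℕ → A))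
    (F : List A → ENNReal) (l : ℕ) :
    ∫⁻ y, F (word y 0 l) ∂μ =
      ∑ v : Fin l → A, F (List.ofFn v) * μ (wordCylinder (List.ofFn v)) := by
  simp only [word_eq_ofFn]
  rw [lintegral_comp_eq_sum (measurable_window 0 l) fun v => F (List.ofFn v)]
  refine Finset.sum_congr rfl fun v _ => ?_
  congr 2
  ext y
  simp [wordCylinder, word_eq_ofFn]

lemma sum_cylProb [Fintype A] [MeasurableSingletonClass A] (μ : Measure (ℕ → A))
    [IsProbabilityMeasure μ] (l : ℕ) : ∑ v : Fin l → A, cylProb μ (List.ofFn v) = 1 := by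
  have h := lintegral_initialWord μ 1 l
  simp only [Pi.one_apply, lintegral_const, measure_univ, mul_one, one_mul] at h
  simp only [cylProb, measureReal_def]
  rw [← ENNReal.toReal_sum fun v _ => measure_ne_top _ _, ← h, ENNReal.toReal_one]

end Cylinders

section Pressure

lemma coe_mul_div_coe_mul {θ a : ℝ} (hθ : θ ≠ 0) (x : EReal) :
    (θ : EReal) * x / ((θ * a : ℝ) : EReal) = x / (a : EReal) := by
  rw [EReal.coe_mul, mul_comm, mul_comm (θ : EReal), EReal.mul_div_mul_cancel (EReal.coe_ne_bot θ)
    (EReal.coe_ne_top θ) (EReal.coe_ne_zero.2 hθ)]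

variable {A : Type*} [Fintype A] [MeasurableSpace A] {P Q : Measure (ℕ → A)}

/-- The slope between `0` and `α` of the pressure, which vanishes at `0`. Its monotonicity replaces
the convexity of the pressure. -/
noncomputable def pressureSlope (P Q : Measure (ℕ → A)) (α : ℝ) : EReal :=
  pressure P Q α / (α : EReal)

lemma exists_pressure_lt_of_lt_sSup {R : ℝ}
    (h : (R : EReal) < sSup (pressureSlope P Q '' Set.Iio 0)) :
    ∃ α < 0, pressure P Q α < ((α * R : ℝ) : EReal) := by
  obtain ⟨_, ⟨α, hα : α < 0, rfl⟩, h⟩ := lt_sSup_iff.1 h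
  refine ⟨α, hα, lt_of_not_ge fun hc => h.not_ge ?_⟩
  have hdiv := EReal.div_le_div_right_of_nonpos (EReal.coe_le_coe hα.le) hc
  rwa [← EReal.coe_div, mul_div_cancel_left₀ _ hα.ne] at hdiv

lemma exists_pressure_lt_of_sInf_lt {R : ℝ}
    (h : sInf (pressureSlope P Q '' Set.Ioi 0) < (R : EReal)) :
    ∃ α > 0, pressure P Q α < ((α * R : ℝ) : EReal) := by
  obtain ⟨_, ⟨α, hα : 0 < α, rfl⟩, h⟩ := sInf_lt_iff.1 h
  refine ⟨α, hα, ?_⟩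
  rwa [pressureSlope, EReal.div_lt_iff (EReal.coe_pos.2 hα) (EReal.coe_ne_top α), ← EReal.coe_mul,
    mul_comm] at h

lemma eventually_pressureSum_le {α r : ℝ} (h : pressure P Q α < (r : EReal)) :
    ∀ᶠ n : ℕ in atTop, pressureSum P Q α n ≤ Real.exp (r * n) := by
  filter_upwards [eventually_lt_of_limsup_lt h, eventually_gt_atTop 0] with n hn hn0
  have hlog : Real.log (pressureSum P Q α n) < r * n := by
    rwa [EReal.coe_lt_coe_iff, one_div, inv_mul_lt_iff₀ (Nat.cast_pos.2 hn0), mul_comm] at hn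
  rcases le_or_gt (pressureSum P Q α n) 0 with h0 | h0
  · exact h0.trans (Real.exp_pos _).le
  · exact ((Real.log_lt_iff_lt_exp h0).1 hlog).le

variable [MeasurableSingletonClass A] [IsProbabilityMeasure Q]

lemma sum_cylProb_filter (hPQ : ∀ a, 0 < cylProb Q a → 0 < cylProb P a) (n : ℕ) :
    ∑ v : Fin n → A with 0 < cylProb P (List.ofFn v), cylProb Q (List.ofFn v) = 1 := by
  rw [← sum_cylProb Q n]
  refine Finset.sum_filter_of_ne fun v _ hv => hPQ _ ?_
  exact (cylProb_nonneg Q _).lt_of_ne' hv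

lemma pressureSum_pos (hPQ : ∀ a, 0 < cylProb Q a → 0 < cylProb P a) (α : ℝ) (n : ℕ) :
    0 < pressureSum P Q α n := by
  have hsum := sum_cylProb_filter hPQ n
  obtain ⟨v, hv, hpos⟩ := Finset.exists_lt_of_sum_lt (s := Finset.univ.filter
    fun v : Fin n → A => 0 < cylProb P (List.ofFn v)) (f := fun _ => (0 : ℝ))
    (g := fun v => cylProb Q (List.ofFn v)) (by simp [hsum])
  refine Finset.sum_pos' (fun w _ => mul_nonneg (Real.rpow_nonneg (cylProb_nonneg P _) _)
    (cylProb_nonneg Q _)) ⟨v, hv, mul_pos (Real.rpow_pos_of_pos ?_ _) hpos⟩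
  exact (Finset.mem_filter.1 hv).2

lemma pressureSum_mul_le (hPQ : ∀ a, 0 < cylProb Q a → 0 < cylProb P a) (α : ℝ) {θ : ℝ}
    (h0 : 0 < θ) (h1 : θ ≤ 1) (n : ℕ) : pressureSum P Q (θ * α) n ≤ pressureSum P Q α n ^ θ := by
  have jensen := Real.rpow_arith_mean_le_arith_mean_rpow
    (Finset.univ.filter fun v : Fin n → A => 0 < cylProb P (List.ofFn v))
    (fun v => cylProb Q (List.ofFn v)) (fun v => cylProb P (List.ofFn v) ^ (-(θ * α)))
    (fun v _ => cylProb_nonneg Q _) (sum_cylProb_filter hPQ n)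
    (fun v _ => Real.rpow_nonneg (cylProb_nonneg P _) _) (p := θ⁻¹) ((one_le_inv₀ h0).2 h1)
  have hpow (v : Fin n → A) : (cylProb P (List.ofFn v) ^ (-(θ * α))) ^ θ⁻¹ =
      cylProb P (List.ofFn v) ^ (-α) := by
    rw [← Real.rpow_mul (cylProb_nonneg P _)]
    congr 1
    field_simp
  simp only [hpow, mul_comm (cylProb Q _)] at jensen
  exact (Real.rpow_inv_le_iff_of_pos (pressureSum_pos hPQ _ n).le (pressureSum_pos hPQ _ n).le
    h0).1 jensen

lemma pressure_zero (hPQ : ∀ a, 0 < cylProb Q a → 0 < cylProb P a) : pressure P Q 0 = 0 := by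
  have h : ∀ n, pressureSum P Q 0 n = 1 := fun n => by
    simp [pressureSum, sum_cylProb_filter hPQ n]
  simp [pressure, h]

lemma pressure_mul_le (hPQ : ∀ a, 0 < cylProb Q a → 0 < cylProb P a) (α : ℝ) {θ : ℝ}
    (h0 : 0 < θ) (h1 : θ ≤ 1) : pressure P Q (θ * α) ≤ (θ : EReal) * pressure P Q α := by
  rw [pressure, pressure, ← EReal.limsup_const_mul_of_nonneg_of_ne_top
    (EReal.coe_nonneg.2 h0.le) (EReal.coe_ne_top θ)]
  refine limsup_le_limsup (Eventually.of_forall fun n => ?_)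
  beta_reduce
  rw [← EReal.coe_mul, EReal.coe_le_coe_iff, mul_left_comm,
    ← Real.log_rpow (pressureSum_pos hPQ α n)]
  gcongr
  · exact pressureSum_pos hPQ _ n
  · exact pressureSum_mul_le hPQ α h0 h1 n

lemma pressureSlope_mul_le_of_pos (hPQ : ∀ a, 0 < cylProb Q a → 0 < cylProb P a) {α θ : ℝ}
    (hα : 0 < α) (h0 : 0 < θ) (h1 : θ ≤ 1) : pressureSlope P Q (θ * α) ≤ pressureSlope P Q α := by
  rw [pressureSlope, pressureSlope, ← coe_mul_div_coe_mul h0.ne' (pressure P Q α)]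
  exact EReal.div_le_div_right_of_nonneg (EReal.coe_nonneg.2 (mul_pos h0 hα).le)
    (pressure_mul_le hPQ α h0 h1)

lemma le_pressureSlope_mul_of_neg (hPQ : ∀ a, 0 < cylProb Q a → 0 < cylProb P a) {α θ : ℝ}
    (hα : α < 0) (h0 : 0 < θ) (h1 : θ ≤ 1) : pressureSlope P Q α ≤ pressureSlope P Q (θ * α) := by
  rw [pressureSlope, pressureSlope, ← coe_mul_div_coe_mul h0.ne' (pressure P Q α)]
  exact EReal.div_le_div_right_of_nonpos
    (EReal.coe_le_coe (mul_neg_of_pos_of_neg h0 hα).le) (pressure_mul_le hPQ α h0 h1)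

lemma monotoneOn_pressureSlope_Iio (hPQ : ∀ a, 0 < cylProb Q a → 0 < cylProb P a) :
    MonotoneOn (pressureSlope P Q) (Set.Iio 0) := by
  intro a (ha : a < 0) b (hb : b < 0) hab
  have h := le_pressureSlope_mul_of_neg hPQ ha (div_pos_of_neg_of_neg hb ha)
    ((div_le_one_of_neg ha).2 hab)
  rwa [div_mul_cancel₀ _ ha.ne] at h

lemma monotoneOn_pressureSlope_Ioi (hPQ : ∀ a, 0 < cylProb Q a → 0 < cylProb P a) :
    MonotoneOn (pressureSlope P Q) (Set.Ioi 0) := by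
  intro a (ha : 0 < a) b (hb : 0 < b) hab
  have h := pressureSlope_mul_le_of_pos hPQ hb (div_pos ha hb) ((div_le_one hb).2 hab)
  rwa [div_mul_cancel₀ _ hb.ne'] at h

lemma hasLeftDeriv_pressure (hPQ : ∀ a, 0 < cylProb Q a → 0 < cylProb P a) :
    HasLeftDeriv (pressure P Q) 0 (sSup (pressureSlope P Q '' Set.Iio 0)) := by
  simp only [HasLeftDeriv, pressure_zero hPQ, sub_zero]
  exact (monotoneOn_pressureSlope_Iio hPQ).tendsto_nhdsLT (OrderTop.bddAbove _)

lemma hasRightDeriv_pressure (hPQ : ∀ a, 0 < cylProb Q a → 0 < cylProb P a) :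
    HasRightDeriv (pressure P Q) 0 (sInf (pressureSlope P Q '' Set.Ioi 0)) := by
  simp only [HasRightDeriv, pressure_zero hPQ, sub_zero]
  exact (monotoneOn_pressureSlope_Ioi hPQ).tendsto_nhdsGT (OrderBot.bddBelow _)

lemma lintegral_cylProb_rpow (hPQ : ∀ a, 0 < cylProb Q a → 0 < cylProb P a) (α : ℝ) (n : ℕ) :
    ∫⁻ y, ENNReal.ofReal (cylProb P (word y 0 n) ^ (-α)) ∂Q =
      ENNReal.ofReal (pressureSum P Q α n) := by
  have hsum : pressureSum P Q α n =
      ∑ v : Fin n → A, cylProb P (List.ofFn v) ^ (-α) * cylProb Q (List.ofFn v) :=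
    Finset.sum_filter_of_ne fun v _ hv =>
      hPQ _ ((cylProb_nonneg Q _).lt_of_ne' (right_ne_zero_of_mul hv))
  have hnn (a : List A) : 0 ≤ cylProb P a ^ (-α) := Real.rpow_nonneg (cylProb_nonneg P a) _
  rw [lintegral_initialWord Q fun a => ENNReal.ofReal (cylProb P a ^ (-α)), hsum,
    ENNReal.ofReal_sum_of_nonneg fun v _ => mul_nonneg (hnn _) (cylProb_nonneg Q _)]
  simp only [ENNReal.ofReal_mul (hnn _), ofReal_cylProb]

end Pressure

section Asymptotic

lemma eventually_le_mul_of_isLittleO {u : ℕ → ℝ} (hu : u =o[atTop] fun n : ℕ => (n : ℝ)) {ε : ℝ}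
    (hε : 0 < ε) : ∀ᶠ n : ℕ in atTop, u n ≤ ε * n := by
  filter_upwards [hu.def hε] with n hn
  exact (le_abs_self _).trans (by simpa using hn)

lemma summable_exp_neg_mul {ε : ℝ} (hε : 0 < ε) : Summable fun n : ℕ => Real.exp (-ε * n) :=
  (summable_geometric_of_lt_one (Real.exp_pos _).le
    (Real.exp_lt_one_iff.2 (neg_neg_of_pos hε))).congr fun n => by rw [← Real.exp_nat_mul, mul_comm]

lemma exists_sum_Ioc_le {c : ℕ → ENNReal} {b : ℕ → ℝ} (hb : Summable b)
    (hc : ∀ᶠ n in atTop, c n ≤ ENNReal.ofReal (b n)) {η : ENNReal} (hη : 0 < η) :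
    ∃ m, ∀ N, ∑ l ∈ Finset.Ioc m N, c l ≤ η := by
  have htail := (ENNReal.tendsto_sum_nat_add (fun n => ENNReal.ofReal (b n))
    hb.tsum_ofReal_lt_top.ne).eventually_le_const hη
  obtain ⟨m, hm, hcm⟩ := (htail.and (eventually_forall_ge_atTop.2 hc)).exists
  refine ⟨m, fun N => ?_⟩
  calc ∑ l ∈ Finset.Ioc m N, c l
      ≤ ∑ l ∈ Finset.Ioc m N, ENNReal.ofReal (b l) :=
        Finset.sum_le_sum fun l hl => hcm l (Finset.mem_Ioc.1 hl).1.le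
    _ ≤ ∑ l ∈ Finset.Ico m (N + 1), ENNReal.ofReal (b l) :=
        Finset.sum_le_sum_of_subset fun l hl => by
          simp only [Finset.mem_Ioc, Finset.mem_Ico] at hl ⊢
          omega
    _ = ∑ k ∈ Finset.range (N + 1 - m), ENNReal.ofReal (b (k + m)) := by
        simp only [Finset.sum_Ico_eq_sum_range, Nat.add_comm]
    _ ≤ η := (ENNReal.sum_le_tsum _).trans hm

end Asymptotic

section BorelCantelli

variable {Ω : Type*} [MeasurableSpace Ω] {μ : Measure Ω}

lemma ae_eventually_notMem_of_summable {s : ℕ → Set Ω} {b : ℕ → ℝ} (hb : Summable b)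
    (h : ∀ᶠ n in atTop, μ (s n) ≤ ENNReal.ofReal (b n)) : ∀ᵐ x ∂μ, ∀ᶠ n in atTop, x ∉ s n := by
  obtain ⟨n₀, hn₀⟩ := eventually_atTop.1 h
  have hb' : Summable fun n => b (n + n₀) := (summable_nat_add_iff n₀).2 hb
  have hs : ∑' n, μ (s (n + n₀)) ≠ ⊤ :=
    ((ENNReal.tsum_le_tsum fun n => hn₀ (n + n₀) (by omega)).trans_lt hb'.tsum_ofReal_lt_top).ne
  filter_upwards [ae_eventually_notMem hs] with x hx
  rwa [← map_add_atTop_eq_nat n₀]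

lemma ae_eventually_le_exp_mul {f : ℕ → Ω → ENNReal} (hf : ∀ n, Measurable (f n)) {s t : ℝ}
    (hst : s < t) (h : ∀ᶠ n : ℕ in atTop, ∫⁻ ω, f n ω ∂μ ≤ ENNReal.ofReal (Real.exp (s * n))) :
    ∀ᵐ ω ∂μ, ∀ᶠ n : ℕ in atTop, f n ω ≤ ENNReal.ofReal (Real.exp (t * n)) := by
  have hmarkov : ∀ᶠ n : ℕ in atTop, μ {ω | ENNReal.ofReal (Real.exp (t * n)) ≤ f n ω} ≤
      ENNReal.ofReal (Real.exp (-(t - s) * n)) := by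
    filter_upwards [h] with n hn
    refine (meas_ge_le_lintegral_div (hf n).aemeasurable
      (ENNReal.ofReal_pos.2 (Real.exp_pos _)).ne' ENNReal.ofReal_ne_top).trans ?_
    rw [show -(t - s) * (n : ℝ) = s * n - t * n by ring, Real.exp_sub,
      ENNReal.ofReal_div_of_pos (Real.exp_pos _)]
    gcongr
  filter_upwards [ae_eventually_notMem_of_summable (summable_exp_neg_mul (sub_pos.2 hst)) hmarkov]
    with ω hω
  filter_upwards [hω] with n hn using (not_le.1 hn).le

end BorelCantelli

section Decoupling

variable {A : Type*} [MeasurableSpace A] {Q : Measure (ℕ → A)}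

/-- Upper decoupling across an unspecified gap: a word `a` is nearly independent, up to the factor
`exp (u |a|)`, of the words that start `τ |a|` letters after its end. -/
def GapDecoupled (Q : Measure (ℕ → A)) (u : ℕ → ℝ) (τ : ℕ → ℕ) : Prop :=
  ∀ a b : List A, a ≠ [] →
    Q.real {y | word y 0 a.length = a ∧ word y (a.length + τ a.length) b.length = b} ≤
      Real.exp (u a.length) * (cylProb Q a * cylProb Q b)

lemma one_le_card_of_isProbabilityMeasure [Fintype A] (Q : Measure (ℕ → A))
    [IsProbabilityMeasure Q] :
    1 ≤ Fintype.card A := by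
  obtain ⟨y⟩ := nonempty_of_isProbabilityMeasure Q
  exact Fintype.card_pos_iff.2 ⟨y 0⟩

variable [MeasurableSingletonClass A] [IsProbabilityMeasure Q]

lemma gapDecoupled_of_upperDecoupled [Fintype A] (hQ : MeasurePreserving shift Q Q)
    {κ : ℕ → ℝ} {τ : ℕ → ℕ} (hκ : ∀ n, 0 ≤ κ n)
    (hdec : ∀ n : ℕ, 1 ≤ n → ∀ a ∈ wordSupport Q n, ∀ ξ ∈ wordSupport Q (τ n),
      ∀ m : ℕ, 1 ≤ m → ∀ b ∈ wordSupport Q m,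
        cylProb Q (a ++ ξ ++ b) ≤ Real.exp (κ n) * (cylProb Q a * cylProb Q b)) :
    GapDecoupled Q (fun n => κ n + τ n * Real.log (Fintype.card A)) τ := by
  intro a b ha
  set n := a.length
  have hn : 1 ≤ n := List.length_pos_iff.2 ha
  have hcard := one_le_card_of_isProbabilityMeasure Q
  have hterm (ξ : Fin (τ n) → A) :
      cylProb Q (a ++ List.ofFn ξ ++ b) ≤ Real.exp (κ n) * (cylProb Q a * cylProb Q b) := by
    rcases (cylProb_nonneg Q (a ++ List.ofFn ξ ++ b)).eq_or_lt with h0 | h0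
    · rw [← h0]
      exact mul_nonneg (Real.exp_pos _).le (mul_nonneg (cylProb_nonneg Q a) (cylProb_nonneg Q b))
    have haξ := h0.trans_le (cylProb_append_le_left Q _ _)
    have hapos := haξ.trans_le (cylProb_append_le_left Q _ _)
    rcases b with - | ⟨c, b⟩
    · rw [List.append_nil, cylProb_nil, mul_one]
      exact (cylProb_append_le_left Q _ _).trans
        (le_mul_of_one_le_left hapos.le (Real.one_le_exp (hκ n)))
    · exact hdec n hn a ⟨rfl, hapos⟩ _
        ⟨List.length_ofFn, haξ.trans_le (cylProb_append_le_right hQ _ _)⟩ _ (Nat.le_add_left 1 _) _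
        ⟨rfl, h0.trans_le (cylProb_append_le_right hQ _ _)⟩
  calc Q.real {y | word y 0 n = a ∧ word y (n + τ n) b.length = b}
      ≤ Q.real (⋃ ξ : Fin (τ n) → A, wordCylinder (a ++ List.ofFn ξ ++ b)) := by
        refine measureReal_mono fun y hy => Set.mem_iUnion.2 ⟨fun i => y (n + i), ?_⟩
        rw [mem_wordCylinder_iff, word_eq_append_iff, word_eq_append_iff]
        simpa [n, word_eq_ofFn] using hy
    _ ≤ ∑ ξ : Fin (τ n) → A, cylProb Q (a ++ List.ofFn ξ ++ b) := measureReal_iUnion_fintype_le _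
    _ ≤ (Fintype.card A : ℝ) ^ τ n * (Real.exp (κ n) * (cylProb Q a * cylProb Q b)) := by
        refine (Finset.sum_le_card_nsmul _ _ _ fun ξ _ => hterm ξ).trans_eq ?_
        simp
    _ = Real.exp (κ n + τ n * Real.log (Fintype.card A)) * (cylProb Q a * cylProb Q b) := by
        rw [Real.exp_add, Real.exp_nat_mul, Real.exp_log (Nat.cast_pos.2 hcard)]
        ring

lemma UpperDecoupled.exists_gapDecoupled [Finite A] (hQ : MeasurePreserving shift Q Q)
    (hUD : UpperDecoupled Q) : ∃ (u : ℕ → ℝ) (τ : ℕ → ℕ),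
      (u =o[atTop] fun n : ℕ => (n : ℝ)) ∧
      ((fun n => (τ n : ℝ)) =o[atTop] fun n : ℕ => (n : ℝ)) ∧ GapDecoupled Q u τ := by
  have := Fintype.ofFinite A
  obtain ⟨κ, τ, ⟨hκ0, hκ, hτ⟩, hdec⟩ := hUD
  refine ⟨_, τ, hκ.add ?_, hτ, gapDecoupled_of_upperDecoupled hQ hκ0 hdec⟩
  simpa only [mul_comm] using hτ.const_mul_left (Real.log (Fintype.card A))

lemma GapDecoupled.lintegral_mul_le [Finite A] {u : ℕ → ℝ} {τ : ℕ → ℕ} (h : GapDecoupled Q u τ)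
    (F G : List A → ENNReal) {n : ℕ} (hn : 1 ≤ n) (M : ℕ) :
    ∫⁻ y, F (word y 0 n) * G (word y (n + τ n) M) ∂Q ≤
      ENNReal.ofReal (Real.exp (u n)) *
        ((∫⁻ y, F (word y 0 n) ∂Q) * ∫⁻ y, G (word y 0 M) ∂Q) := by
  have := Fintype.ofFinite A
  have hX := (measurable_window (A := A) 0 n).prodMk (measurable_window (n + τ n) M)
  have hjoint (v : Fin n → A) (w : Fin M → A) :
      Q ((fun y => ((fun i : Fin n => y (0 + i)), fun i : Fin M => y (n + τ n + i))) ⁻¹' {(v, w)}) ≤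
        ENNReal.ofReal (Real.exp (u n)) *
          (Q (wordCylinder (List.ofFn v)) * Q (wordCylinder (List.ofFn w))) := by
    have hv : List.ofFn v ≠ [] := by rw [Ne, List.ofFn_eq_nil_iff]; omega
    rw [← ofReal_cylProb, ← ofReal_cylProb, ← ENNReal.ofReal_mul (cylProb_nonneg Q _),
      ← ENNReal.ofReal_mul (Real.exp_pos _).le, ← ofReal_measureReal]
    refine ENNReal.ofReal_le_ofReal ?_
    simpa [Set.preimage, word_eq_ofFn] using h (List.ofFn v) (List.ofFn w) hv
  simp only [lintegral_initialWord, word_eq_ofFn _ (n + τ n)]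
  simp only [word_eq_ofFn]
  rw [lintegral_comp_eq_sum hX fun vw => F (List.ofFn vw.1) * G (List.ofFn vw.2),
    Fintype.sum_prod_type, Finset.sum_mul_sum, Finset.mul_sum]
  refine Finset.sum_le_sum fun v _ => ?_
  rw [Finset.mul_sum]
  refine Finset.sum_le_sum fun w _ => (mul_le_mul_right (hjoint v w) _).trans_eq ?_
  ring

end Decoupling

section GapSum

variable {A : Type*}

/-- The sum of the products of the weights `g`, over all families of subwords of the given word that
have lengths above `m` and of which each one is separated from the next one by a gap of the length
prescribed by `τ`. Either the first letter is skipped, or it starts a subword of length `l`. -/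
noncomputable def gapSum (g : List A → ENNReal) (τ : ℕ → ℕ) (m : ℕ) : List A → ENNReal
  | [] => 1
  | a :: w => gapSum g τ m w + ∑ l ∈ Finset.Ioc m (w.length + 1),
      g ((a :: w).take l) * gapSum g τ m (w.drop (l - 1 + τ l))
termination_by w => w.length

/-- The subwords of length `l i` after the position `p i`, for `i ∈ I`, lie in the first `N` letters
and are longer than `m`, and each of them is followed by a gap of length at least `τ (l i)` before
the later ones. -/
def GapSeparated (τ : ℕ → ℕ) (m N : ℕ) (I : Finset ℕ) (p l : ℕ → ℕ) : Prop :=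
  ∀ i ∈ I, m < l i ∧ p i + l i ≤ N ∧ ∀ j ∈ I, i < j → p i + l i + τ (l i) ≤ p j

lemma gapSum_word_succ (g : List A → ENNReal) (τ : ℕ → ℕ) (m : ℕ) (y : ℕ → A) (s N : ℕ) :
    gapSum g τ m (word y s (N + 1)) = gapSum g τ m (word y (s + 1) N) +
      ∑ l ∈ Finset.Ioc m (N + 1), g (word y s l) *
        gapSum g τ m (word y (s + (l + τ l)) (N + 1 - (l + τ l))) := by
  rw [word_succ, gapSum, length_word, ← word_succ]
  congr 1
  refine Finset.sum_congr rfl fun l hl => ?_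
  rw [Finset.mem_Ioc] at hl
  rw [take_word y s hl.2, drop_word]
  congr 3 <;> omega

lemma gapSum_word_anti (g : List A → ENNReal) (τ : ℕ → ℕ) (m N : ℕ) (y : ℕ → A) :
    Antitone fun s => gapSum g τ m (word y s (N - s)) := by
  refine antitone_nat_of_succ_le fun s => ?_
  rcases lt_or_ge s N with h | h
  · rw [show N - s = N - (s + 1) + 1 by omega, gapSum_word_succ]
    exact le_self_add
  · rw [show N - s = 0 by omega, show N - (s + 1) = 0 by omega, word_zero, word_zero]

lemma one_le_gapSum_word (g : List A → ENNReal) (τ : ℕ → ℕ) (m N : ℕ) (y : ℕ → A) (s : ℕ) :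
    1 ≤ gapSum g τ m (word y s (N - s)) := by
  calc 1 = gapSum g τ m (word y (max s N) (N - max s N)) := by simp [gapSum]
    _ ≤ _ := gapSum_word_anti g τ m N y (le_max_left s N)

lemma mul_gapSum_word_le (g : List A → ENNReal) (τ : ℕ → ℕ) {m N : ℕ} (y : ℕ → A) {p l : ℕ}
    (hl : m < l) (hN : p + l ≤ N) :
    g (word y p l) * gapSum g τ m (word y (p + l + τ l) (N - (p + l + τ l))) ≤
      gapSum g τ m (word y p (N - p)) := by
  obtain ⟨d, hd⟩ : ∃ d, N - p = d + 1 := Nat.exists_eq_succ_of_ne_zero (by omega)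
  rw [hd, gapSum_word_succ]
  refine le_add_left (le_trans (le_of_eq ?_) (Finset.single_le_sum (fun _ _ => zero_le)
    (Finset.mem_Ioc.2 ⟨hl, by omega⟩ : l ∈ Finset.Ioc m (d + 1))))
  congr 3 <;> omega

lemma GapSeparated.prod_le_gapSum {τ : ℕ → ℕ} {m N : ℕ} {I : Finset ℕ} {p l : ℕ → ℕ}
    (h : GapSeparated τ m N I p l) (g : List A → ENNReal) (y : ℕ → A) :
    ∏ i ∈ I, g (word y (p i) (l i)) ≤ gapSum g τ m (word y 0 N) := by
  suffices key : ∀ s, (∀ i ∈ I, s ≤ p i) →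
      ∏ i ∈ I, g (word y (p i) (l i)) ≤ gapSum g τ m (word y s (N - s)) from
    key 0 fun i _ => Nat.zero_le _
  induction I using Finset.induction_on_min with
  | empty => exact fun s _ => by simpa using one_le_gapSum_word g τ m N y s
  | insert a I ha ih =>
    intro s hs
    obtain ⟨hm, hN, hgap⟩ := h a (Finset.mem_insert_self a I)
    have hI : GapSeparated τ m N I p l := fun i hi =>
      have ⟨hm, hN, hgap⟩ := h i (Finset.mem_insert_of_mem hi)
      ⟨hm, hN, fun j hj => hgap j (Finset.mem_insert_of_mem hj)⟩
    rw [Finset.prod_insert fun hmem => (ha a hmem).false]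
    calc g (word y (p a) (l a)) * ∏ i ∈ I, g (word y (p i) (l i))
        ≤ g (word y (p a) (l a)) * gapSum g τ m
            (word y (p a + l a + τ (l a)) (N - (p a + l a + τ (l a)))) := by
          gcongr
          exact ih hI _ fun j hj => hgap j (Finset.mem_insert_of_mem hj) (ha j hj)
      _ ≤ gapSum g τ m (word y (p a) (N - p a)) := mul_gapSum_word_le g τ y hm hN
      _ ≤ gapSum g τ m (word y s (N - s)) :=
          gapSum_word_anti g τ m N y (hs a (Finset.mem_insert_self a I))

variable [MeasurableSpace A] [Finite A] [MeasurableSingletonClass A] {Q : Measure (ℕ → A)}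
  [IsProbabilityMeasure Q] {u : ℕ → ℝ} {τ : ℕ → ℕ}

lemma GapDecoupled.lintegral_gapSum_le (hQ : MeasurePreserving shift Q Q)
    (hdec : GapDecoupled Q u τ) (g : List A → ENNReal) {m : ℕ} {η : ENNReal}
    (hη : ∀ N, ∑ l ∈ Finset.Ioc m N,
      ENNReal.ofReal (Real.exp (u l)) * ∫⁻ y, g (word y 0 l) ∂Q ≤ η) (N : ℕ) :
    ∫⁻ y, gapSum g τ m (word y 0 N) ∂Q ≤ (1 + η) ^ N := by
  induction N using Nat.strong_induction_on with
  | _ N ih =>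
  rcases N with - | N
  · simp [gapSum]
  have hmeas (s M : ℕ) : Measurable fun y : ℕ → A => gapSum g τ m (word y s M) :=
    measurable_word_comp _ s M
  have hmul (l : ℕ) : Measurable fun y : ℕ → A =>
      g (word y 0 l) * gapSum g τ m (word y (l + τ l) (N + 1 - (l + τ l))) :=
    (measurable_word_comp g 0 l).mul (hmeas _ _)
  have hterm : ∀ l ∈ Finset.Ioc m (N + 1),
      ∫⁻ y, g (word y 0 l) * gapSum g τ m (word y (l + τ l) (N + 1 - (l + τ l))) ∂Q ≤
        ENNReal.ofReal (Real.exp (u l)) * (∫⁻ y, g (word y 0 l) ∂Q) * (1 + η) ^ N := by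
    intro l hl
    rw [Finset.mem_Ioc] at hl
    refine (hdec.lintegral_mul_le g (gapSum g τ m) (by omega) _).trans ?_
    rw [mul_assoc]
    gcongr
    exact (ih _ (by omega)).trans (pow_le_pow_right₀ le_self_add (by omega))
  simp only [gapSum_word_succ, zero_add]
  rw [lintegral_add_left (hmeas 1 N), lintegral_finsetSum _ fun l _ => hmul l,
    lintegral_word_eq hQ (gapSum g τ m) 1 N]
  calc _ ≤ (1 + η) ^ N + ∑ l ∈ Finset.Ioc m (N + 1),
        ENNReal.ofReal (Real.exp (u l)) * (∫⁻ y, g (word y 0 l) ∂Q) * (1 + η) ^ N :=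
        add_le_add (ih N N.lt_succ_self) (Finset.sum_le_sum hterm)
    _ ≤ (1 + η) ^ N + η * (1 + η) ^ N := by
        rw [← Finset.sum_mul]
        gcongr
        exact hη (N + 1)
    _ = (1 + η) ^ (N + 1) := by ring

lemma GapDecoupled.ae_eventually_gapSum_le (hQ : MeasurePreserving shift Q Q)
    (hdec : GapDecoupled Q u τ) (hu : u =o[atTop] fun n : ℕ => (n : ℝ)) {g : List A → ENNReal}
    {δ ε : ℝ} (hδ : 0 < δ) (hε : 0 < ε)
    (hg : ∀ᶠ n : ℕ in atTop, ∫⁻ y, g (word y 0 n) ∂Q ≤ ENNReal.ofReal (Real.exp (-δ * n))) :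
    ∃ m, ∀ᵐ y ∂Q, ∀ᶠ N : ℕ in atTop,
      gapSum g τ m (word y 0 N) ≤ ENNReal.ofReal (Real.exp (ε * N)) := by
  have hweight : ∀ᶠ n : ℕ in atTop, ENNReal.ofReal (Real.exp (u n)) * ∫⁻ y, g (word y 0 n) ∂Q ≤
      ENNReal.ofReal (Real.exp (-(δ / 2) * n)) := by
    filter_upwards [hg, eventually_le_mul_of_isLittleO hu (half_pos hδ)] with n hgn hun
    refine (mul_le_mul_right hgn _).trans ?_
    rw [← ENNReal.ofReal_mul (Real.exp_pos _).le, ← Real.exp_add]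
    gcongr
    linarith
  obtain ⟨m, hm⟩ := exists_sum_Ioc_le (summable_exp_neg_mul (half_pos hδ)) hweight
    (ENNReal.ofReal_pos.2 (half_pos hε))
  refine ⟨m, ae_eventually_le_exp_mul (fun N => measurable_word_comp _ 0 N) (half_lt_self hε)
    (Eventually.of_forall fun N => (hdec.lintegral_gapSum_le hQ g hm N).trans ?_)⟩
  rw [← ENNReal.ofReal_one, ← ENNReal.ofReal_add zero_le_one (half_pos hε).le,
    ← ENNReal.ofReal_pow (by positivity), mul_comm (ε / 2), Real.exp_nat_mul, add_comm]
  gcongr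
  exact Real.add_one_le_exp (ε / 2)

end GapSum

section LogBound

variable {A : Type*} [Fintype A] [MeasurableSpace A] [MeasurableSingletonClass A]
  {P Q : Measure (ℕ → A)} [IsProbabilityMeasure Q] {u : ℕ → ℝ} {τ : ℕ → ℕ}

lemma ofReal_rpow_mul_exp_prod_le {ι : Type*} (I : Finset ι) {f n : ι → ℝ} {α r t : ℝ}
    (hf : ∀ i ∈ I, 0 < f i)
    (h : ∏ i ∈ I, ENNReal.ofReal (f i ^ (-α) * Real.exp (-r * n i)) ≤
      ENNReal.ofReal (Real.exp t)) :
    α * ∑ i ∈ I, -Real.log (f i) ≤ r * ∑ i ∈ I, n i + t := by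
  have hfactor : ∀ i ∈ I, f i ^ (-α) * Real.exp (-r * n i) =
      Real.exp (α * -Real.log (f i) - r * n i) := fun i hi => by
    rw [Real.rpow_def_of_pos (hf i hi), ← Real.exp_add]
    ring_nf
  rw [← ENNReal.ofReal_prod_of_nonneg fun i hi => hfactor i hi ▸ (Real.exp_pos _).le,
    ENNReal.ofReal_le_ofReal_iff (Real.exp_pos _).le, Finset.prod_congr rfl hfactor,
    ← Real.exp_sum, Real.exp_le_exp, Finset.sum_sub_distrib, ← Finset.mul_sum,
    ← Finset.mul_sum] at h
  linarith

theorem GapDecoupled.ae_eventually_mul_sum_neg_log_le (hQ : MeasurePreserving shift Q Q)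
    (hPQ : ∀ a, 0 < cylProb Q a → 0 < cylProb P a) (hdec : GapDecoupled Q u τ)
    (hu : u =o[atTop] fun n : ℕ => (n : ℝ)) {α r ε : ℝ} (hr : pressure P Q α < (r : EReal))
    (hε : 0 < ε) :
    ∃ m, ∀ᵐ y ∂Q, ∀ᶠ N : ℕ in atTop, ∀ (I : Finset ℕ) (p l : ℕ → ℕ), GapSeparated τ m N I p l →
      α * ∑ i ∈ I, -Real.log (cylProb P (word y (p i) (l i))) ≤
        r * ∑ i ∈ I, (l i : ℝ) + ε * N := by
  obtain ⟨q, hq, hqr⟩ := EReal.lt_iff_exists_real_btwn.1 hr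
  have hqr : q < r := EReal.coe_lt_coe_iff.1 hqr
  let g (a : List A) : ENNReal := ENNReal.ofReal (cylProb P a ^ (-α) * Real.exp (-r * a.length))
  have hg : ∀ᶠ n : ℕ in atTop,
      ∫⁻ y, g (word y 0 n) ∂Q ≤ ENNReal.ofReal (Real.exp (-(r - q) * n)) := by
    filter_upwards [eventually_pressureSum_le hq] with n hn
    simp only [g, length_word, ENNReal.ofReal_mul' (Real.exp_pos _).le]
    rw [lintegral_mul_const _ (measurable_word_comp (fun a => ENNReal.ofReal (cylProb P a ^ (-α)))
      0 n), lintegral_cylProb_rpow hPQ, ← ENNReal.ofReal_mul' (Real.exp_pos _).le,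
      show -(r - q) * (n : ℝ) = q * n + -r * n by ring, Real.exp_add]
    gcongr
  obtain ⟨m, hm⟩ := hdec.ae_eventually_gapSum_le hQ hu (sub_pos.2 hqr) hε hg
  refine ⟨m, ?_⟩
  filter_upwards [hm, ae_cylProb_word_pos hQ hPQ] with y hy hpos
  filter_upwards [hy] with N hN I p l hI
  have hprod := (hI.prod_le_gapSum g y).trans hN
  simp only [g, length_word] at hprod
  exact ofReal_rpow_mul_exp_prod_le I (fun i _ => hpos _ _) hprod

end LogBound

section Growth

lemma eventually_forall_le_mul_of_isLittleO {u : ℕ → ℝ} (hu : u =o[atTop] fun n : ℕ => (n : ℝ))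
    {ε : ℝ} (hε : 0 < ε) : ∀ᶠ k : ℕ in atTop, ∀ n ≤ k, u n ≤ ε * k := by
  obtain ⟨n₀, hn₀⟩ := eventually_atTop.1 (eventually_le_mul_of_isLittleO hu hε)
  have hsmall : ∀ᶠ k : ℕ in atTop, ∀ n ∈ Finset.range n₀, u n ≤ ε * k :=
    (Filter.eventually_all_finset _).2 fun n _ =>
      (tendsto_natCast_atTop_atTop.const_mul_atTop hε).eventually_ge_atTop (u n)
  filter_upwards [hsmall] with k hk n hn
  rcases lt_or_ge n n₀ with h | h
  · exact hk n (Finset.mem_range.2 h)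
  · exact (hn₀ n h).trans (by gcongr)

lemma eventually_mul_le_exp {c : ℝ} (hc : 0 < c) (a : ℝ) :
    ∀ᶠ k : ℕ in atTop, a * k ≤ Real.exp (c * k) := by
  have h : (fun x : ℝ => a * x) =o[atTop] fun x => Real.exp (c * x) := by
    simpa using (isLittleO_pow_exp_pos_mul_atTop 1 hc).const_mul_left a
  filter_upwards [(h.comp_tendsto tendsto_natCast_atTop_atTop).def zero_lt_one] with k hk
  calc a * k ≤ |a * k| := le_abs_self _
    _ ≤ Real.exp (c * k) := by simpa only [Function.comp_apply, one_mul, Real.norm_eq_abs,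
        Real.abs_exp] using hk

lemma two_pow_eq_exp (k : ℕ) : (2 : ℝ) ^ k = Real.exp (Real.log 2 * k) := by
  rw [mul_comm, Real.exp_nat_mul, Real.exp_log two_pos]

lemma exp_half_mul_le_two_pow (k : ℕ) : Real.exp (1 / 2 * k) ≤ 2 ^ k := by
  rw [two_pow_eq_exp]
  gcongr
  linarith [Real.log_two_gt_d9]

end Growth

section Occurrence

variable {A : Type*}

/-- The sequences whose first `N` letters do not contain the word `a`. -/
def avoiding (a : List A) (N : ℕ) : Set (ℕ → A) :=
  {x | ∀ r, r + a.length ≤ N → word x r a.length ≠ a}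

lemma mem_avoiding_congr {a : List A} {N : ℕ} {x y : ℕ → A} (h : ∀ i < N, x i = y i) :
    x ∈ avoiding a N ↔ y ∈ avoiding a N := by
  refine forall₂_congr fun r hr => ?_
  rw [word_eq_word_iff.2 fun i hi => h (r + i) (by omega)]

lemma avoiding_anti (a : List A) : Antitone (avoiding a) :=
  fun _ _ h _ hx r hr => hx r (hr.trans h)

lemma shift_iterate_mem_avoiding {a : List A} {d N : ℕ} {x : ℕ → A} (hx : x ∈ avoiding a (d + N)) :
    shift^[d] x ∈ avoiding a N := fun r hr => by
  rw [word_shift_iterate]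
  exact hx (d + r) (by omega)

variable [MeasurableSpace A] {P : Measure (ℕ → A)}

/-- The inequality of selective lower decoupling for the words of length `n`, with the constant `κ`
and with connecting words of length at most `t`. -/
def SelectivelyDecoupledAt (P : Measure (ℕ → A)) (n t : ℕ) (κ : ℝ) : Prop :=
  ∀ a ∈ wordSupport P n, ∀ m : ℕ, 1 ≤ m → ∀ b ∈ wordSupport P m,
    ∃ l : ℕ, l ≤ t ∧ ∃ ξ ∈ wordSupport P l,
      Real.exp (-κ) * (cylProb P a * cylProb P b) ≤ cylProb P (a ++ ξ ++ b)

lemma exp_neg_mul_cylProb_le_one (P : Measure (ℕ → A)) [IsProbabilityMeasure P] {κ : ℝ}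
    (hκ : 0 ≤ κ) (a : List A) : Real.exp (-κ) * cylProb P a ≤ 1 :=
  mul_le_one₀ (Real.exp_le_one_iff.2 (neg_nonpos.2 hκ)) (cylProb_nonneg P a) (cylProb_le_one P a)

variable [MeasurableSingletonClass A]

lemma measureReal_word_eq [Countable A] (hP : MeasurePreserving shift P P) (s : ℕ) (a : List A) :
    P.real {y | word y s a.length = a} = cylProb P a := by
  rw [cylProb, measureReal_def, measureReal_def, measure_word_eq hP]

lemma measureReal_eq_sum_word [Fintype A] [IsFiniteMeasure P] (S : Set (ℕ → A)) (s l : ℕ) :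
    P.real S = ∑ v : Fin l → A, P.real ({x | word x s l = List.ofFn v} ∩ S) := by
  have h := sum_measureReal_preimage_singleton (μ := P.restrict S)
    (Finset.univ : Finset (Fin l → A)) fun v _ =>
      measurable_window s l (measurableSet_singleton v)
  rw [Finset.coe_univ, Set.preimage_univ, measureReal_restrict_apply_univ] at h
  rw [← h]
  refine Finset.sum_congr rfl fun v _ => ?_
  rw [measureReal_restrict_apply (measurable_window s l (measurableSet_singleton v))]
  simp [Set.preimage, word_eq_ofFn]

variable [IsProbabilityMeasure P]

section OneStep

variable {t : ℕ} {κ : ℝ} {a : List A}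

/-- An occurrence of `a ++ ξ ++ b` that ends together with `b` starts within the gap before `b`. -/
lemma SelectivelyDecoupledAt.measureReal_word_inter_avoiding_le [Countable A]
    (hP : MeasurePreserving shift P P) (h : SelectivelyDecoupledAt P a.length t κ)
    (ha : 0 < cylProb P a) {b : List A} (hb : 1 ≤ b.length) :
    P.real ({x | word x (a.length + t) b.length = b} ∩ avoiding a (a.length + t + b.length)) ≤
      (1 - Real.exp (-κ) * cylProb P a) * cylProb P b := by
  set B : Set (ℕ → A) := {x | word x (a.length + t) b.length = b}
  have hPB : P.real B = cylProb P b := measureReal_word_eq hP _ b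
  rcases (cylProb_nonneg P b).eq_or_lt with hb0 | hb0
  · rw [← hb0, mul_zero, hb0, ← hPB]
    exact measureReal_mono Set.inter_subset_left
  obtain ⟨j, hj, ξ, ⟨hξ, -⟩, hle⟩ := h a ⟨rfl, ha⟩ _ hb b ⟨rfl, hb0⟩
  set E : Set (ℕ → A) := {x | word x (t - j) (a ++ ξ ++ b).length = a ++ ξ ++ b}
  have hEB : E ⊆ B := fun y hy => by
    have hyb := (word_eq_append_iff.1 hy).2
    rwa [List.length_append, hξ, show t - j + (a.length + j) = a.length + t by omega] at hyb
  have hEa : B ∩ avoiding a (a.length + t + b.length) ⊆ B \ E := by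
    rintro y ⟨hyB, hya⟩
    refine ⟨hyB, fun hyE => hya (t - j) (by omega) ?_⟩
    exact (word_eq_append_iff.1 (word_eq_append_iff.1 hyE).1).1
  calc P.real (B ∩ avoiding a (a.length + t + b.length)) ≤ P.real (B \ E) := measureReal_mono hEa
    _ = cylProb P b - cylProb P (a ++ ξ ++ b) := by
        rw [measureReal_sdiff hEB (measurableSet_word_eq _ _ _), hPB, measureReal_word_eq hP]
    _ ≤ (1 - Real.exp (-κ) * cylProb P a) * cylProb P b := by linarith

variable [Finite A]

lemma SelectivelyDecoupledAt.measureReal_avoiding_add_le (hP : MeasurePreserving shift P P)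
    (hκ : 0 ≤ κ) (h : SelectivelyDecoupledAt P a.length t κ) (ha : 0 < cylProb P a) {m : ℕ}
    (hm : 1 ≤ m) :
    P.real (avoiding a (a.length + t + m)) ≤
      (1 - Real.exp (-κ) * cylProb P a) * P.real (avoiding a m) := by
  have := Fintype.ofFinite A
  set d := a.length + t with hd
  have hu := exp_neg_mul_cylProb_le_one P hκ a
  rw [measureReal_eq_sum_word (avoiding a (d + m)) d m,
    measureReal_eq_sum_word (avoiding a m) 0 m, Finset.mul_sum]
  refine Finset.sum_le_sum fun v _ => ?_
  set b := List.ofFn v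
  have hbm : b.length = m := List.length_ofFn
  rcases ({x | word x d m = b} ∩ avoiding a (d + m)).eq_empty_or_nonempty with h0 | ⟨x, hxb, hxa⟩
  · rw [h0, measureReal_empty]
    exact mul_nonneg (by linarith) measureReal_nonneg
  have hcyl : {y : ℕ → A | word y 0 m = b} ∩ avoiding a m = wordCylinder b := by
    rw [wordCylinder, hbm]
    refine Set.inter_eq_left.2 fun y hy => ?_
    refine (mem_avoiding_congr fun i hi => ?_).2 (shift_iterate_mem_avoiding hxa)
    have hyx : word y 0 m = word x d m := hy.trans hxb.symm
    simpa using word_eq_word_iff.1 hyx i hi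
  have hle := h.measureReal_word_inter_avoiding_le hP ha (b := b) (by omega)
  rwa [hbm, ← hd, show cylProb P b = P.real (wordCylinder b) from rfl, ← hcyl] at hle

lemma SelectivelyDecoupledAt.measureReal_avoiding_le_pow (hP : MeasurePreserving shift P P)
    (hκ : 0 ≤ κ) (h : SelectivelyDecoupledAt P a.length t κ) (ha : 0 < cylProb P a) (J : ℕ) :
    P.real (avoiding a (1 + J * (a.length + t))) ≤ (1 - Real.exp (-κ) * cylProb P a) ^ J := by
  induction J with
  | zero => simp
  | succ J ih =>
    rw [show 1 + (J + 1) * (a.length + t) = a.length + t + (1 + J * (a.length + t)) by ring,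
      pow_succ']
    refine (h.measureReal_avoiding_add_le hP hκ ha (by omega)).trans ?_
    exact mul_le_mul_of_nonneg_left ih (sub_nonneg.2 (exp_neg_mul_cylProb_le_one P hκ a))

lemma SelectivelyDecoupledAt.mul_measureReal_avoiding_le (hP : MeasurePreserving shift P P)
    (hκ : 0 ≤ κ) (h : SelectivelyDecoupledAt P a.length t κ) (ha : 0 < cylProb P a) {N : ℕ}
    (hN : 0 < N) (hd : 0 < a.length + t) :
    Real.exp (-κ) * cylProb P a * N * P.real (avoiding a N) ≤ 2 * (a.length + t : ℕ) := by
  set d := a.length + t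
  set w := Real.exp (-κ) * cylProb P a
  set J := (N - 1) / d
  have hw0 : 0 ≤ w := mul_nonneg (Real.exp_pos _).le (cylProb_nonneg P a)
  have hw1 : w ≤ 1 := exp_neg_mul_cylProb_le_one P hκ a
  have hJN : 1 + J * d ≤ N := by
    have : J * d ≤ N - 1 := Nat.div_mul_le_self (N - 1) d
    omega
  have hNJ : (N : ℝ) ≤ d + J * d := by
    have h1 : N - 1 < J * d + d := Nat.lt_div_mul_add hd
    exact_mod_cast (by omega : N ≤ d + J * d)
  have hexp : P.real (avoiding a N) ≤ Real.exp (-(w * J)) :=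
    calc P.real (avoiding a N) ≤ P.real (avoiding a (1 + J * d)) :=
          measureReal_mono (avoiding_anti a hJN)
      _ ≤ (1 - w) ^ J := h.measureReal_avoiding_le_pow hP hκ ha J
      _ ≤ Real.exp (-w) ^ J := pow_le_pow_left₀ (by linarith) (Real.one_sub_le_exp_neg w) J
      _ = Real.exp (-(w * J)) := by rw [← Real.exp_nat_mul, mul_neg, mul_comm]
  have hJp : w * J * P.real (avoiding a N) ≤ 1 :=
    calc w * J * P.real (avoiding a N) ≤ w * J * Real.exp (-(w * J)) := by gcongr
      _ ≤ Real.exp (-1) := Real.mul_exp_neg_le_exp_neg_one _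
      _ ≤ 1 := Real.exp_le_one_iff.2 (by norm_num)
  have hp1 : w * P.real (avoiding a N) ≤ 1 := mul_le_one₀ hw1 measureReal_nonneg measureReal_le_one
  calc w * N * P.real (avoiding a N) ≤ w * (d + J * d) * P.real (avoiding a N) := by gcongr
    _ = d * (w * P.real (avoiding a N) + w * J * P.real (avoiding a N)) := by ring
    _ ≤ d * (1 + 1) := by gcongr
    _ = 2 * (d : ℕ) := by ring

end OneStep

lemma SelectivelyLowerDecoupled.ae_occurs [Finite A] (hP : MeasurePreserving shift P P)
    (hSLD : SelectivelyLowerDecoupled P) :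
    ∀ᵐ x ∂P, ∀ a : List A, 0 < cylProb P a → ∃ r, word x r a.length = a := by
  obtain ⟨κ, τ, ⟨hκ, -, -⟩, hdec⟩ := hSLD
  refine ae_all_iff.2 fun a => ?_
  rcases (cylProb_nonneg P a).eq_or_lt with ha | ha
  · exact Eventually.of_forall fun _ h => absurd h ha.not_lt
  rcases a.eq_nil_or_concat with rfl | ⟨b, c, rfl⟩
  · exact Eventually.of_forall fun _ _ => ⟨0, rfl⟩
  set a := b.concat c with ha_def
  have hd : SelectivelyDecoupledAt P a.length (τ a.length) (κ a.length) :=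
    hdec _ (by simp [ha_def])
  have hpow (J : ℕ) : P.real {x | ∀ r, word x r a.length ≠ a} ≤
      (1 - Real.exp (-κ a.length) * cylProb P a) ^ J := by
    refine le_trans (measureReal_mono ?_) (hd.measureReal_avoiding_le_pow hP (hκ _) ha J)
    exact fun x hx r _ => hx r
  have hlim := tendsto_pow_atTop_nhds_zero_of_lt_one
    (sub_nonneg.2 (exp_neg_mul_cylProb_le_one P (hκ a.length) a))
    (sub_lt_self 1 (mul_pos (Real.exp_pos (-κ a.length)) ha))
  have hzero : P.real {x | ∀ r, word x r a.length ≠ a} = 0 :=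
    (ge_of_tendsto' hlim hpow).antisymm measureReal_nonneg
  filter_upwards [measure_eq_zero_iff_ae_notMem.1 ((measureReal_eq_zero_iff).1 hzero)] with x hx _
  simpa using hx

lemma card_filter_le_cylProb_mul_le_one [Fintype A] (P : Measure (ℕ → A)) [IsProbabilityMeasure P]
    (n : ℕ) (q : ℝ) :
    (Finset.univ.filter fun v : Fin n → A => q ≤ cylProb P (List.ofFn v)).card * q ≤ 1 := by
  rw [← nsmul_eq_mul, ← sum_cylProb P n]
  refine (Finset.card_nsmul_le_sum _ _ q fun v hv => (Finset.mem_filter.1 hv).2).trans ?_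
  exact Finset.sum_le_univ_sum_of_nonneg fun v => cylProb_nonneg P _

lemma SelectivelyDecoupledAt.mul_measureReal_exists_avoiding_le [Finite A]
    (hP : MeasurePreserving shift P P) {n t : ℕ} {κ : ℝ} (hκ : 0 ≤ κ)
    (h : SelectivelyDecoupledAt P n t κ) (hn : 0 < n) {q : ℝ} (hq : 0 < q) {N : ℕ} (hN : 0 < N) :
    q ^ 2 * Real.exp (-κ) * N *
      P.real {x | ∃ a : List A, a.length = n ∧ q ≤ cylProb P a ∧ x ∈ avoiding a N} ≤
        2 * (n + t : ℕ) := by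
  have := Fintype.ofFinite A
  set S := Finset.univ.filter fun v : Fin n → A => q ≤ cylProb P (List.ofFn v) with hS
  have hcover : {x | ∃ a : List A, a.length = n ∧ q ≤ cylProb P a ∧ x ∈ avoiding a N} ⊆
      ⋃ v ∈ S, avoiding (List.ofFn v) N := by
    rintro x ⟨a, rfl, hqa, hx⟩
    exact Set.mem_biUnion (x := a.get) (by simpa [S] using hqa) (by simpa using hx)
  have hword : ∀ v ∈ S, q * Real.exp (-κ) * N * P.real (avoiding (List.ofFn v) N) ≤
      2 * (n + t : ℕ) := fun v hv => by
    have hqv : q ≤ cylProb P (List.ofFn v) := (Finset.mem_filter.1 hv).2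
    have hv := SelectivelyDecoupledAt.mul_measureReal_avoiding_le (a := List.ofFn v) (t := t) hP hκ
      (by rwa [List.length_ofFn]) (hq.trans_le hqv) hN (by rw [List.length_ofFn]; omega)
    rw [List.length_ofFn] at hv
    refine le_trans ?_ hv
    rw [mul_comm q]
    gcongr
  calc q ^ 2 * Real.exp (-κ) * N * _
      ≤ q ^ 2 * Real.exp (-κ) * N * ∑ v ∈ S, P.real (avoiding (List.ofFn v) N) := by
        gcongr
        exact (measureReal_mono hcover (measure_ne_top _ _)).trans
          (measureReal_biUnion_finset_le _ _)
    _ = q * ∑ v ∈ S, q * Real.exp (-κ) * N * P.real (avoiding (List.ofFn v) N) := by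
        rw [← Finset.mul_sum]
        ring
    _ ≤ q * ∑ _v ∈ S, 2 * ((n + t : ℕ) : ℝ) :=
        mul_le_mul_of_nonneg_left (Finset.sum_le_sum hword) hq.le
    _ = S.card * q * (2 * ((n + t : ℕ) : ℝ)) := by
        rw [Finset.sum_const, nsmul_eq_mul]
        ring
    _ ≤ 2 * (n + t : ℕ) :=
        mul_le_of_le_one_left (by positivity) (card_filter_le_cylProb_mul_le_one P n q)

theorem SelectivelyLowerDecoupled.ae_eventually_occurs [Finite A] (hP : MeasurePreserving shift P P)
    (hSLD : SelectivelyLowerDecoupled P) {ℓ : ℕ → ℕ} (hℓ : ∀ᶠ k in atTop, 1 ≤ ℓ k ∧ ℓ k ≤ k) :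
    ∀ᵐ x ∂P, ∀ᶠ k : ℕ in atTop, ∀ a : List A, a.length = ℓ k →
      Real.exp (-(k / 8)) ≤ cylProb P a → ∃ r, r + a.length ≤ 2 ^ k ∧ word x r a.length = a := by
  obtain ⟨κ, τ, ⟨hκ, hκo, hτo⟩, hdec⟩ := hSLD
  have hmiss : ∀ᶠ k : ℕ in atTop, P {x | ∃ a : List A, a.length = ℓ k ∧
      Real.exp (-(k / 8)) ≤ cylProb P a ∧ x ∈ avoiding a (2 ^ k)} ≤
        ENNReal.ofReal (Real.exp (-(1 / 8) * k)) := by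
    filter_upwards [hℓ, eventually_forall_le_mul_of_isLittleO hκo (by norm_num : (0 : ℝ) < 1 / 16),
      eventually_forall_le_mul_of_isLittleO hτo zero_lt_one,
      eventually_mul_le_exp (by norm_num : (0 : ℝ) < 1 / 16) 4] with k ⟨hℓ1, hℓk⟩ hκk hτk h4k
    have hd : SelectivelyDecoupledAt P (ℓ k) (τ (ℓ k)) (κ (ℓ k)) := hdec _ hℓ1
    have hle := hd.mul_measureReal_exists_avoiding_le hP (hκ _) hℓ1 (Real.exp_pos (-(k / 8)))
      (Nat.two_pow_pos k)
    rw [← ofReal_measureReal]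
    refine ENNReal.ofReal_le_ofReal ?_
    set p := P.real _
    have hfactor : Real.exp (3 / 16 * k) ≤
        Real.exp (-(k / 8)) ^ 2 * Real.exp (-κ (ℓ k)) * (2 ^ k : ℕ) := by
      rw [Nat.cast_pow, Nat.cast_ofNat, ← Real.exp_nat_mul, ← Real.exp_add]
      refine le_trans ?_ (mul_le_mul_of_nonneg_left (exp_half_mul_le_two_pow k) (Real.exp_pos _).le)
      rw [← Real.exp_add]
      gcongr
      push_cast
      linarith [hκk _ hℓk]
    have hd4 : 2 * ((ℓ k + τ (ℓ k) : ℕ) : ℝ) ≤ Real.exp (1 / 16 * k) := by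
      have : (ℓ k : ℝ) ≤ k := Nat.cast_le.2 hℓk
      push_cast
      linarith [hτk _ hℓk]
    rw [show -(1 / 8) * (k : ℝ) = 1 / 16 * k - 3 / 16 * k by ring, Real.exp_sub,
      le_div_iff₀' (Real.exp_pos _)]
    exact (mul_le_mul_of_nonneg_right hfactor measureReal_nonneg).trans (hle.trans hd4)
  filter_upwards [ae_eventually_notMem_of_summable (summable_exp_neg_mul (by norm_num)) hmiss]
    with x hx
  filter_upwards [hx] with k hk a ha haP
  by_contra! hocc
  exact hk ⟨a, ha, haP, hocc⟩

end Occurrence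

section Parsing

variable {A : Type*}

lemma waitingTime_add_le_iff {l N : ℕ} {y x : ℕ → A} :
    waitingTime l y x + (l : ℕ∞) ≤ (N : ℕ∞) + 1 ↔ ∃ r, r + l ≤ N ∧ word x r l = word y 0 l := by
  constructor
  · intro h
    rcases Set.eq_empty_or_nonempty
      {w : ℕ∞ | ∃ r : ℕ, 1 ≤ r ∧ word x (r - 1) l = word y 0 l ∧ w = (r : ℕ∞)} with h0 | h0
    · rw [waitingTime, h0, sInf_empty, top_add, top_le_iff] at h
      exact absurd h (by exact_mod_cast ENat.natCast_ne_top (N + 1))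
    · obtain ⟨r, hr1, hr2, hr3⟩ := csInf_mem h0
      refine ⟨r - 1, ?_, hr2⟩
      rw [waitingTime, hr3] at h
      have : r + l ≤ N + 1 := by exact_mod_cast h
      omega
  · rintro ⟨r, hr, hw⟩
    have h1 : waitingTime l y x ≤ ((r + 1 : ℕ) : ℕ∞) := sInf_le ⟨r + 1, by omega, hw, rfl⟩
    refine (add_le_add_left h1 _).trans ?_
    have : r + 1 + l ≤ N + 1 := by omega
    exact_mod_cast this

/-- The lengths of the prefixes of `y` that occur in `x₁ … x_N`. -/
def matchingLengths (N : ℕ) (y x : ℕ → A) : Set ℕ :=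
  {l | 1 ≤ l ∧ ∃ r, r + l ≤ N ∧ word x r l = word y 0 l}

lemma matchLength_eq (N : ℕ) (y x : ℕ → A) :
    matchLength N y x = max 1 (sSup (matchingLengths N y x)) := by
  simp only [matchLength, waitingTime_add_le_iff, matchingLengths]

lemma bddAbove_matchingLengths (N : ℕ) (y x : ℕ → A) : BddAbove (matchingLengths N y x) :=
  ⟨N, fun _ ⟨_, _, hr, _⟩ => (Nat.le_add_left _ _).trans hr⟩

lemma le_matchLength {N p r l : ℕ} {y x : ℕ → A} (hr : r + l ≤ N)
    (hw : word x r l = word y p l) : l ≤ matchLength N (shift^[p] y) x := by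
  rcases Nat.eq_zero_or_pos l with rfl | hl
  · exact Nat.zero_le _
  · rw [matchLength_eq]
    refine le_max_of_le_right (le_csSup (bddAbove_matchingLengths _ _ _) ⟨hl, r, hr, ?_⟩)
    rw [word_shift_iterate, Nat.add_zero, hw]

lemma exists_eq_of_two_le_matchLength {N p : ℕ} {y x : ℕ → A}
    (h : 2 ≤ matchLength N (shift^[p] y) x) :
    ∃ r, r + matchLength N (shift^[p] y) x ≤ N ∧
      word x r (matchLength N (shift^[p] y) x) = word y p (matchLength N (shift^[p] y) x) := by
  have hne : (matchingLengths N (shift^[p] y) x).Nonempty := by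
    by_contra hempty
    rw [matchLength_eq, Set.not_nonempty_iff_eq_empty.1 hempty] at h
    simp at h
  have hmem := Nat.sSup_mem hne (bddAbove_matchingLengths _ _ _)
  rw [← max_eq_right hmem.1, ← matchLength_eq] at hmem
  obtain ⟨-, r, hr, hw⟩ := hmem
  exact ⟨r, hr, by rw [hw, word_shift_iterate, Nat.add_zero]⟩

variable (N : ℕ) (y x : ℕ → A)

lemma parseEnd_le (i : ℕ) : parseEnd N y x i ≤ N := by
  cases i with
  | zero => exact Nat.zero_le _
  | succ i => exact min_le_left _ _

lemma parseEnd_succ (i : ℕ) : parseEnd N y x (i + 1) =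
    min N (parseEnd N y x i + matchLength N (shift^[parseEnd N y x i] y) x + 1) := rfl

lemma parseEnd_monotone : Monotone (parseEnd N y x) := by
  refine monotone_nat_of_le_succ fun i => ?_
  rw [parseEnd_succ]
  exact le_min (parseEnd_le N y x i) (by omega)

lemma parseEnd_parseCount : parseEnd N y x (parseCount N y x) = N := by
  have h : ∀ i, min N i ≤ parseEnd N y x i := fun i => by
    induction i with
    | zero => simp
    | succ i ih =>
      rw [parseEnd_succ]
      omega
  exact Nat.sInf_mem (s := {i : ℕ | parseEnd N y x i = N})
    ⟨N, le_antisymm (parseEnd_le N y x N) (by simpa using h N)⟩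

variable {N y x}

lemma parseEnd_lt {i : ℕ} (hi : i < parseCount N y x) : parseEnd N y x i < N :=
  (parseEnd_le N y x i).lt_of_ne fun h => Nat.notMem_of_lt_sInf hi h

lemma parseEnd_succ_eq {i : ℕ} (hi : i + 1 < parseCount N y x) : parseEnd N y x (i + 1) =
    parseEnd N y x i + matchLength N (shift^[parseEnd N y x i] y) x + 1 := by
  have h := parseEnd_lt hi
  rw [parseEnd_succ] at h ⊢
  omega

variable (N y x)

/-- The length of the word with number `i + 1` of the parsing; it is `0` from `c_N(y|x)` on. -/
noncomputable def parseLength (i : ℕ) : ℕ := parseEnd N y x (i + 1) - parseEnd N y x i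

lemma parseEnd_add_parseLength (i : ℕ) :
    parseEnd N y x i + parseLength N y x i = parseEnd N y x (i + 1) :=
  Nat.add_sub_cancel' (parseEnd_monotone N y x (Nat.le_succ i))

lemma parsedWord_eq (i : ℕ) :
    parsedWord N y x i = word y (parseEnd N y x i) (parseLength N y x i) := rfl

lemma trimmedWord_eq (i : ℕ) :
    trimmedWord N y x i = word y (parseEnd N y x i) (parseLength N y x i - 1) := by
  rw [trimmedWord, parsedWord_eq, dropLast_word]

lemma sum_parseLength (c : ℕ) :
    ∑ i ∈ Finset.range c, parseLength N y x i = parseEnd N y x c := by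
  induction c with
  | zero => rfl
  | succ c ih => rw [Finset.sum_range_succ, ih, parseEnd_add_parseLength]

variable {N y x}

lemma parseLength_eq {i : ℕ} (hi : i + 1 < parseCount N y x) :
    parseLength N y x i = matchLength N (shift^[parseEnd N y x i] y) x + 1 := by
  rw [parseLength, parseEnd_succ_eq hi]
  omega

lemma lt_parseLength {i n : ℕ} (hi : i + 1 < parseCount N y x)
    (h : ∀ p, ∃ r, r + n ≤ N ∧ word x r n = word y p n) : n < parseLength N y x i := by
  rw [parseLength_eq hi]
  obtain ⟨r, hr, hw⟩ := h (parseEnd N y x i)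
  exact Nat.lt_succ_of_le (le_matchLength hr hw)

lemma word_ne_of_parseLength_le {i n r : ℕ} (hi : i + 1 < parseCount N y x)
    (hn : parseLength N y x i ≤ n) (hr : r + n ≤ N) :
    word x r n ≠ word y (parseEnd N y x i) n := by
  intro hw
  have := le_matchLength hr hw
  rw [parseLength_eq hi] at hn
  omega

lemma exists_word_eq_of_lt_parseLength {i n : ℕ} (hi : i + 1 < parseCount N y x)
    (h2 : 2 ≤ n) (hn : n < parseLength N y x i) :
    ∃ r, r + n ≤ N ∧ word x r n = word y (parseEnd N y x i) n := by
  rw [parseLength_eq hi] at hn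
  obtain ⟨r, hr, hw⟩ := exists_eq_of_two_le_matchLength (N := N) (p := parseEnd N y x i) (y := y)
    (x := x) (by omega)
  refine ⟨r, by omega, ?_⟩
  rw [word_eq_word_iff] at hw ⊢
  exact fun j hj => hw j (by omega)

lemma parseLength_le_succ {i m : ℕ} (hi : i + 1 < parseCount N y x) (hm : 2 ≤ m)
    (h : ∀ r < N, ∀ s < N, word x r m ≠ word y s m) : parseLength N y x i ≤ m + 1 := by
  by_contra! hlt
  obtain ⟨r, hr, hw⟩ := exists_word_eq_of_lt_parseLength hi hm (Nat.lt_of_succ_lt hlt)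
  exact h r (by omega) _ (parseEnd_lt (Nat.lt_of_succ_lt hi)) hw

lemma strictMonoOn_parseEnd : StrictMonoOn (parseEnd N y x) (Set.Iio (parseCount N y x)) := by
  intro i _ j hj hij
  have hj : j < parseCount N y x := hj
  have hsucc := parseEnd_succ_eq (N := N) (y := y) (x := x) (show i + 1 < _ by omega)
  have hmono : parseEnd N y x (i + 1) ≤ parseEnd N y x j := parseEnd_monotone N y x hij
  omega

lemma parseCount_lt (hN : 2 < N) (h : ∀ i, i + 1 < parseCount N y x → 1 < parseLength N y x i) :
    parseCount N y x < N := by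
  have hsum : ∑ _i ∈ Finset.range (parseCount N y x - 1), 2 ≤ N :=
    calc _ ≤ ∑ i ∈ Finset.range (parseCount N y x - 1), parseLength N y x i :=
          Finset.sum_le_sum fun i hi => h i (by have := Finset.mem_range.1 hi; omega)
      _ ≤ N := (sum_parseLength N y x _).trans_le (parseEnd_le N y x _)
  simp only [Finset.sum_const, Finset.card_range, smul_eq_mul] at hsum
  omega

lemma le_sum_parseLength_filter_add {M : ℕ}
    (h : ∀ i, i + 1 < parseCount N y x → M ≤ parseLength N y x i) :
    N ≤ ∑ i ∈ Finset.range (parseCount N y x) with M ≤ parseLength N y x i, parseLength N y x i +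
      M := by
  set c := parseCount N y x
  have hlast : (Finset.range c).filter (¬ M ≤ parseLength N y x ·) ⊆ {c - 1} := fun i hi => by
    obtain ⟨hic, hiM⟩ := Finset.mem_filter.1 hi
    have := mt (h i) hiM
    rw [Finset.mem_range] at hic
    rw [Finset.mem_singleton]
    omega
  have hshort : ∑ i ∈ Finset.range c with ¬ M ≤ parseLength N y x i, parseLength N y x i ≤ M :=
    calc _ ≤ ∑ i ∈ Finset.range c with ¬ M ≤ parseLength N y x i, M :=
          Finset.sum_le_sum fun i hi => (not_le.1 (Finset.mem_filter.1 hi).2).le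
      _ ≤ ∑ _i ∈ {c - 1}, M := Finset.sum_le_sum_of_subset hlast
      _ = M := Finset.sum_singleton _ _
  have htotal : ∑ i ∈ Finset.range c, parseLength N y x i = N :=
    (sum_parseLength N y x c).trans (parseEnd_parseCount N y x)
  rw [← Finset.sum_filter_add_sum_filter_not _ (M ≤ parseLength N y x ·)] at htotal
  omega

end Parsing

section LowerBound

lemma eventually_exists_gap {τ : ℕ → ℕ} (hτ : (fun n => (τ n : ℝ)) =o[atTop] fun n : ℕ => (n : ℝ))
    (m : ℕ) {δ : ℝ} (hδ0 : 0 < δ) (hδ1 : δ < 1) :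
    ∀ᶠ n : ℕ in atTop, ∃ l, m < l ∧ l < n ∧ l + τ l ≤ n ∧ (1 - δ) * n ≤ l := by
  have hlim : Tendsto (fun n : ℕ => (1 - δ) * n) atTop atTop :=
    tendsto_natCast_atTop_atTop.const_mul_atTop (sub_pos.2 hδ1)
  have hτceil : ∀ᶠ n : ℕ in atTop, (τ ⌈(1 - δ) * n⌉₊ : ℝ) ≤ δ / 2 * ⌈(1 - δ) * n⌉₊ :=
    (tendsto_nat_ceil_atTop.comp hlim).eventually
      (eventually_le_mul_of_isLittleO hτ (half_pos hδ0))
  filter_upwards [hτceil, hlim.eventually_gt_atTop (m : ℝ),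
    tendsto_natCast_atTop_atTop.eventually_gt_atTop (2 / δ)] with n hτn hm hn
  rw [div_lt_iff₀' hδ0] at hn
  have hceil : (⌈(1 - δ) * n⌉₊ : ℝ) < (1 - δ) * n + 1 :=
    Nat.ceil_lt_add_one (m.cast_nonneg.trans hm.le)
  have hlt : (⌈(1 - δ) * n⌉₊ : ℝ) < n := by linarith
  refine ⟨_, Nat.lt_ceil.2 hm, Nat.cast_lt.1 hlt, ?_, Nat.le_ceil _⟩
  rw [← Nat.cast_le (α := ℝ), Nat.cast_add]
  linarith [mul_le_mul_of_nonneg_left hlt.le (half_pos hδ0).le]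

variable {A : Type*} {τ : ℕ → ℕ} {m M N : ℕ} {y x : ℕ → A} {l : ℕ → ℕ}

lemma gapSeparated_shortened (hl : ∀ n, M ≤ n → m < l n ∧ l n + τ (l n) ≤ n) :
    GapSeparated τ m N {i ∈ Finset.range (parseCount N y x) | M ≤ parseLength N y x i}
      (parseEnd N y x) (fun i => l (parseLength N y x i)) := by
  intro i hi
  obtain ⟨hm, hgap⟩ := hl _ (Finset.mem_filter.1 hi).2
  have hend := parseEnd_add_parseLength N y x i
  have hN := parseEnd_le N y x (i + 1)
  refine ⟨hm, ?_, fun j _ hij => ?_⟩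
  · dsimp only
    omega
  · have hmono : parseEnd N y x (i + 1) ≤ parseEnd N y x j := parseEnd_monotone N y x hij
    dsimp only
    omega

lemma sub_le_sum_shortened {δ : ℝ} (hδ : 0 ≤ δ) (hl : ∀ n : ℕ, M ≤ n → (1 - δ) * n ≤ l n)
    (h : ∀ i, i + 1 < parseCount N y x → M ≤ parseLength N y x i) :
    (1 - δ) * N - M ≤ ∑ i ∈ Finset.range (parseCount N y x) with M ≤ parseLength N y x i,
      (l (parseLength N y x i) : ℝ) := by
  set I := (Finset.range (parseCount N y x)).filter (M ≤ parseLength N y x ·)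
  have hlong : (N : ℝ) ≤ ∑ i ∈ I, (parseLength N y x i : ℝ) + M := by
    exact_mod_cast le_sum_parseLength_filter_add h
  have htotal : ∑ i ∈ I, (parseLength N y x i : ℝ) ≤ N := by
    have hsub : ∑ i ∈ I, parseLength N y x i ≤
        ∑ i ∈ Finset.range (parseCount N y x), parseLength N y x i :=
      Finset.sum_le_sum_of_subset (Finset.filter_subset _ _)
    rw [sum_parseLength, parseEnd_parseCount] at hsub
    exact_mod_cast hsub
  calc (1 - δ) * N - M
      ≤ (1 - δ) * ∑ i ∈ I, (parseLength N y x i : ℝ) := by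
        linarith [mul_le_mul_of_nonneg_left htotal hδ]
    _ ≤ ∑ i ∈ I, (l (parseLength N y x i) : ℝ) := by
        rw [Finset.mul_sum]
        exact Finset.sum_le_sum fun i hi => hl _ (Finset.mem_filter.1 hi).2

variable [MeasurableSpace A]

lemma neg_log_cylProb_nonneg (P : Measure (ℕ → A)) [IsProbabilityMeasure P] (a : List A) :
    0 ≤ -Real.log (cylProb P a) :=
  neg_nonneg.2 (Real.log_nonpos (cylProb_nonneg P a) (cylProb_le_one P a))

lemma sum_shortened_le_sum_trimmedWord {P : Measure (ℕ → A)} [IsProbabilityMeasure P]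
    (hpos : ∀ s n, 0 < cylProb P (word y s n)) (hl : ∀ n, M ≤ n → l n < n) :
    ∑ i ∈ Finset.range (parseCount N y x) with M ≤ parseLength N y x i,
        -Real.log (cylProb P (word y (parseEnd N y x i) (l (parseLength N y x i)))) ≤
      ∑ i ∈ Finset.range (parseCount N y x), -Real.log (cylProb P (trimmedWord N y x i)) := by
  refine (Finset.sum_le_sum fun i hi => ?_).trans (Finset.sum_le_sum_of_subset_of_nonneg
    (Finset.filter_subset _ _) fun i _ _ => neg_log_cylProb_nonneg P _)
  rw [trimmedWord_eq, neg_le_neg_iff]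
  exact Real.log_le_log (hpos _ _)
    (cylProb_word_anti P y _ (Nat.le_sub_one_of_lt (hl _ (Finset.mem_filter.1 hi).2)))

lemma eventually_occurs_of_occurs [Finite A] {P : Measure (ℕ → A)}
    (h : ∀ a : List A, 0 < cylProb P a → ∃ r, word x r a.length = a) (n : ℕ) :
    ∀ᶠ N in atTop, ∀ a : List A, a.length = n → 0 < cylProb P a →
      ∃ r, r + n ≤ N ∧ word x r n = a := by
  refine (eventually_all_finite (List.finite_length_eq A n)).2 fun a ha => ?_
  by_cases hP : 0 < cylProb P a
  · obtain ⟨r, hr⟩ := h a hP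
    filter_upwards [eventually_ge_atTop (r + n)] with N hN _
    exact ⟨r, hN, by rwa [← show a.length = n from ha]⟩
  · exact Eventually.of_forall fun _ h => absurd h hP

variable [MeasurableSingletonClass A] {P Q : Measure (ℕ → A)} [IsProbabilityMeasure P]
  [IsProbabilityMeasure Q]

lemma ae_eventually_lt_parseLength [Finite A] (hP : MeasurePreserving shift P P)
    (hQ : MeasurePreserving shift Q Q) (hPQ : ∀ a, 0 < cylProb Q a → 0 < cylProb P a)
    (hSLD : SelectivelyLowerDecoupled P) :
    ∀ᵐ p : (ℕ → A) × (ℕ → A) ∂(P.prod Q), ∀ n, ∀ᶠ N : ℕ in atTop,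
      ∀ i, i + 1 < parseCount N p.2 p.1 → n < parseLength N p.2 p.1 i := by
  filter_upwards [Measure.quasiMeasurePreserving_fst.ae (hSLD.ae_occurs hP),
    Measure.quasiMeasurePreserving_snd.ae (ae_cylProb_word_pos hQ hPQ)] with p hocc hpos n
  filter_upwards [eventually_occurs_of_occurs hocc n] with N hN i hi
  exact lt_parseLength hi fun s => hN _ (length_word _ _ _) (hpos s n)

variable [Fintype A]

lemma ae_eventually_mul_le_sum_trimmedWord (hP : MeasurePreserving shift P P)
    (hQ : MeasurePreserving shift Q Q) (hPQ : ∀ a, 0 < cylProb Q a → 0 < cylProb P a)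
    (hSLD : SelectivelyLowerDecoupled P) (hUD : UpperDecoupled Q) {R : ℝ} (hR0 : 0 ≤ R)
    (hR : (R : EReal) < sSup (pressureSlope P Q '' Set.Iio 0)) :
    ∀ᵐ p : (ℕ → A) × (ℕ → A) ∂(P.prod Q), ∀ᶠ N : ℕ in atTop,
      R * N ≤ ∑ i ∈ Finset.range (parseCount N p.2 p.1),
        -Real.log (cylProb P (trimmedWord N p.2 p.1 i)) := by
  obtain ⟨R', hRR', hR'⟩ := EReal.lt_iff_exists_real_btwn.1 hR
  have hRR' : R < R' := EReal.coe_lt_coe_iff.1 hRR'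
  obtain ⟨α, hα, hpressure⟩ := exists_pressure_lt_of_lt_sSup hR'
  obtain ⟨u, τ, hu, hτ, hdec⟩ := hUD.exists_gapDecoupled hQ
  obtain ⟨δ, hδ⟩ : ∃ δ, δ = (R' - R) / (2 * (R' + 1)) := ⟨_, rfl⟩
  have hδ0 : 0 < δ := hδ ▸ div_pos (sub_pos.2 hRR') (by linarith)
  have hδ1 : δ < 1 := by
    rw [hδ, div_lt_one] <;> linarith
  have hδR : δ * (R' + 1) = (R' - R) / 2 := by
    rw [hδ]
    field_simp [show R' + 1 ≠ 0 by linarith]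
  obtain ⟨m, hm⟩ := hdec.ae_eventually_mul_sum_neg_log_le hQ hPQ hu hpressure
    (mul_pos_of_neg_of_neg hα (neg_lt_zero.2 hδ0))
  obtain ⟨M, hM⟩ := eventually_atTop.1 (eventually_exists_gap hτ m hδ0 hδ1)
  choose! l hlm hln hlτ hlδ using hM
  filter_upwards [ae_eventually_lt_parseLength hP hQ hPQ hSLD,
    Measure.quasiMeasurePreserving_snd.ae (ae_cylProb_word_pos hQ hPQ),
    Measure.quasiMeasurePreserving_snd.ae hm] with p hlen hpos hsum
  filter_upwards [hlen M, hsum, (tendsto_natCast_atTop_atTop (R := ℝ)).eventually_ge_atTop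
    (R' * M / ((R' - R) / 2))] with N hlenN hsumN hN
  rw [div_le_iff₀ (half_pos (sub_pos.2 hRR'))] at hN
  have hslope := hsumN _ _ _ (gapSeparated_shortened (N := N) (y := p.2) (x := p.1)
    fun n hn => ⟨hlm n hn, hlτ n hn⟩)
  have htrim := sum_shortened_le_sum_trimmedWord (N := N) (x := p.1) hpos hln
  have hmass := sub_le_sum_shortened hδ0.le hlδ fun i hi => (hlenN i hi).le
  set S := ∑ i ∈ _, -Real.log (cylProb P (word p.2 _ _))
  set Λ := ∑ i ∈ _, (l _ : ℝ)
  have hS : R' * Λ - δ * N ≤ S := le_of_mul_le_mul_left (by linarith) (neg_pos.2 hα)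
  linarith [mul_le_mul_of_nonneg_left hmass (hR0.trans hRR'.le), congrArg (· * (N : ℝ)) hδR]

theorem ae_eventually_le_average_trimmedWord (hP : MeasurePreserving shift P P)
    (hQ : MeasurePreserving shift Q Q) (hPQ : ∀ a, 0 < cylProb Q a → 0 < cylProb P a)
    (hSLD : SelectivelyLowerDecoupled P) (hUD : UpperDecoupled Q) {R : ℝ}
    (hR : (R : EReal) < sSup (pressureSlope P Q '' Set.Iio 0)) :
    ∀ᵐ p : (ℕ → A) × (ℕ → A) ∂(P.prod Q), ∀ᶠ N : ℕ in atTop,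
      R ≤ 1 / ((N : ℝ) - (parseCount N p.2 p.1 : ℝ)) *
        ∑ i ∈ Finset.range (parseCount N p.2 p.1),
          -Real.log (cylProb P (trimmedWord N p.2 p.1 i)) := by
  have hcount : ∀ᵐ p : (ℕ → A) × (ℕ → A) ∂(P.prod Q), ∀ᶠ N : ℕ in atTop,
      0 < (N : ℝ) - parseCount N p.2 p.1 := by
    filter_upwards [ae_eventually_lt_parseLength hP hQ hPQ hSLD] with p hlen
    filter_upwards [hlen 1, eventually_gt_atTop 2] with N hlenN hN
    exact sub_pos.2 (Nat.cast_lt.2 (parseCount_lt hN hlenN))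
  rcases lt_or_ge R 0 with hR0 | hR0
  · filter_upwards [hcount] with p hp
    filter_upwards [hp] with N hN
    exact hR0.le.trans (mul_nonneg (one_div_nonneg.2 hN.le)
      (Finset.sum_nonneg fun i _ => neg_log_cylProb_nonneg P _))
  · filter_upwards [hcount, ae_eventually_mul_le_sum_trimmedWord hP hQ hPQ hSLD hUD hR0 hR]
      with p hp hsum
    filter_upwards [hp, hsum] with N hN hsumN
    rw [one_div, inv_mul_eq_div, le_div_iff₀ hN]
    exact (mul_le_mul_of_nonneg_left (sub_le_self _ (Nat.cast_nonneg _)) hR0).trans hsumN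

end LowerBound

section DyadicScale

variable {A : Type*} [MeasurableSpace A] [MeasurableSingletonClass A]

lemma measurableSet_word_eq_word [Countable A] (r s n : ℕ) :
    MeasurableSet {p : (ℕ → A) × (ℕ → A) | word p.1 r n = word p.2 s n} := by
  simp only [word_eq_word_iff, Set.ofPred_forall]
  refine MeasurableSet.iInter fun i => MeasurableSet.iInter fun _ => measurableSet_eq_fun ?_ ?_
  · exact (measurable_pi_apply _).comp measurable_fst
  · exact (measurable_pi_apply _).comp measurable_snd

variable [Fintype A] {P Q : Measure (ℕ → A)}

section SumRpow

variable [IsProbabilityMeasure Q]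

lemma ae_eventually_sum_rpow_le (hQ : MeasurePreserving shift Q Q)
    (hPQ : ∀ a, 0 < cylProb Q a → 0 < cylProb P a) {t r s v : ℝ}
    (h : pressure P Q t < (r : EReal)) {ℓ : ℕ → ℕ} (hℓ : Tendsto ℓ atTop atTop)
    (hs : ∀ᶠ k : ℕ in atTop, Real.log 2 * (k + 1) + r * ℓ k ≤ s * k) (hsv : s < v) :
    ∀ᵐ y ∂Q, ∀ᶠ k : ℕ in atTop,
      ∑ i ∈ Finset.range (2 ^ (k + 1)), cylProb P (word y i (ℓ k)) ^ (-t) ≤ Real.exp (v * k) := by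
  have hmeas (i n : ℕ) : Measurable fun y => ENNReal.ofReal (cylProb P (word y i n) ^ (-t)) :=
    measurable_word_comp (fun a => ENNReal.ofReal (cylProb P a ^ (-t))) i n
  have hint : ∀ᶠ k : ℕ in atTop, ∫⁻ y, ∑ i ∈ Finset.range (2 ^ (k + 1)),
      ENNReal.ofReal (cylProb P (word y i (ℓ k)) ^ (-t)) ∂Q ≤
        ENNReal.ofReal (Real.exp (s * k)) := by
    filter_upwards [hℓ.eventually (eventually_pressureSum_le h), hs] with k hk hsk
    rw [lintegral_finsetSum _ fun i _ => hmeas i (ℓ k)]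
    simp only [lintegral_word_eq hQ (fun a => ENNReal.ofReal (cylProb P a ^ (-t))),
      lintegral_cylProb_rpow hPQ, Finset.sum_const, Finset.card_range]
    rw [← ENNReal.ofReal_nsmul, nsmul_eq_mul]
    refine ENNReal.ofReal_le_ofReal ?_
    calc ((2 ^ (k + 1) : ℕ) : ℝ) * pressureSum P Q t (ℓ k)
        ≤ ((2 ^ (k + 1) : ℕ) : ℝ) * Real.exp (r * ℓ k) := by gcongr
      _ = Real.exp (Real.log 2 * (k + 1) + r * ℓ k) := by
          rw [Real.exp_add, Nat.cast_pow, Nat.cast_ofNat, two_pow_eq_exp, Nat.cast_succ]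
      _ ≤ Real.exp (s * k) := Real.exp_le_exp.2 hsk
  filter_upwards [ae_eventually_le_exp_mul (fun k => Finset.measurable_fun_sum _ fun i _ =>
    hmeas i (ℓ k)) hsv hint] with y hy
  filter_upwards [hy] with k hk
  rwa [← ENNReal.ofReal_sum_of_nonneg fun i _ => Real.rpow_nonneg (cylProb_nonneg P _) _,
    ENNReal.ofReal_le_ofReal_iff (Real.exp_pos _).le] at hk

lemma exists_ae_eventually_neg_log_le (hQ : MeasurePreserving shift Q Q)
    (hPQ : ∀ a, 0 < cylProb Q a → 0 < cylProb P a) {t r : ℝ} (ht : 0 < t)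
    (h : pressure P Q t < (r : EReal)) {C : ℕ} (hC : 1 ≤ C) :
    ∃ B : ℝ, 0 < B ∧ ∀ᵐ y ∂Q, ∀ᶠ k : ℕ in atTop, ∀ i < 2 ^ (k + 1),
      -Real.log (cylProb P (word y i (C * k + 1))) ≤ B * k := by
  have hℓ : Tendsto (fun k : ℕ => C * k + 1) atTop atTop :=
    tendsto_atTop_mono (fun k => (Nat.le_mul_of_pos_left k hC).trans (Nat.le_succ _)) tendsto_id
  have hs : ∀ᶠ k : ℕ in atTop,
      Real.log 2 * (k + 1) + r * (C * k + 1 : ℕ) ≤ (|r| * C + 2) * k := by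
    filter_upwards [tendsto_natCast_atTop_atTop.eventually_ge_atTop (Real.log 2 + |r|)]
      with k hk
    have hrC : r * (C * k) ≤ |r| * (C * k) := by
      gcongr
      exact le_abs_self r
    push_cast
    nlinarith [le_abs_self r, Real.log_two_lt_d9, (k.cast_nonneg : (0 : ℝ) ≤ k)]
  refine ⟨(|r| * C + 3) / t, by positivity, ?_⟩
  filter_upwards [ae_eventually_sum_rpow_le hQ hPQ h hℓ hs
    (by linarith : |r| * C + 2 < |r| * C + 3), ae_cylProb_word_pos hQ hPQ] with y hy hpos
  filter_upwards [hy] with k hk i hi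
  have hle := (Finset.single_le_sum (fun j _ => Real.rpow_nonneg (cylProb_nonneg P
    (word y j (C * k + 1))) (-t)) (Finset.mem_range.2 hi)).trans hk
  rw [Real.rpow_def_of_pos (hpos _ _), Real.exp_le_exp] at hle
  rw [div_mul_eq_mul_div, le_div_iff₀ ht]
  linarith

/-- With words of length `k / K`, the moment of order `-t` costs a factor of about
`exp (t R k / K) ≤ exp (t k / 32)`, whereas each improbable position contributes `exp (t k / 8)`. -/
lemma ae_eventually_card_improbable_le (hQ : MeasurePreserving shift Q Q)
    (hPQ : ∀ a, 0 < cylProb Q a → 0 < cylProb P a) {t R : ℝ} (ht : 0 < t) (hR : 0 ≤ R)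
    (h : pressure P Q t < ((t * R : ℝ) : EReal)) {K : ℕ} (hK : K ≠ 0) (hRK : 32 * R ≤ K) :
    ∀ᵐ y ∂Q, ∀ᶠ k : ℕ in atTop,
      ((Finset.range (2 ^ (k + 1))).filter fun i =>
        cylProb P (word y i (k / K)) < Real.exp (-(k / 8))).card ≤
          2 ^ k * Real.exp (-(t / 16) * k) := by
  have hs : ∀ᶠ k : ℕ in atTop, Real.log 2 * (k + 1) + t * R * (k / K : ℕ) ≤
      (Real.log 2 + 3 / 64 * t) * k := by
    filter_upwards [tendsto_natCast_atTop_atTop.eventually_ge_atTop (64 * Real.log 2 / t)]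
      with k hk
    rw [div_le_iff₀ ht] at hk
    have hRk : R * (k / K : ℕ) ≤ k / 32 :=
      calc R * (k / K : ℕ) ≤ R * (k / K) := mul_le_mul_of_nonneg_left Nat.cast_div_le hR
        _ = R / K * k := by ring
        _ ≤ 1 / 32 * k := by
            refine mul_le_mul_of_nonneg_right ?_ k.cast_nonneg
            rw [div_le_iff₀ (by positivity)]
            linarith
        _ = k / 32 := by ring
    linarith [mul_le_mul_of_nonneg_left hRk ht.le]
  filter_upwards [ae_eventually_sum_rpow_le hQ hPQ h (Nat.tendsto_div_const_atTop hK) hs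
    (by linarith : Real.log 2 + 3 / 64 * t < Real.log 2 + t / 16), ae_cylProb_word_pos hQ hPQ]
    with y hy hpos
  filter_upwards [hy] with k hk
  set S := (Finset.range (2 ^ (k + 1))).filter fun i =>
    cylProb P (word y i (k / K)) < Real.exp (-(k / 8))
  have hcard : S.card * Real.exp (t / 8 * k) ≤ Real.exp ((Real.log 2 + t / 16) * k) := by
    rw [← nsmul_eq_mul, ← Finset.sum_const]
    refine (Finset.sum_le_sum fun i hi => ?_).trans ((Finset.sum_le_sum_of_subset_of_nonneg
      (Finset.filter_subset _ _) fun i _ _ => Real.rpow_nonneg (cylProb_nonneg P _) _).trans hk)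
    calc Real.exp (t / 8 * k) = Real.exp (-(k / 8)) ^ (-t) := by
          rw [← Real.exp_mul]
          ring_nf
      _ ≤ cylProb P (word y i (k / K)) ^ (-t) :=
          Real.rpow_le_rpow_of_nonpos (hpos _ _) (Finset.mem_filter.1 hi).2.le (by linarith)
  rw [← le_div_iff₀ (Real.exp_pos _), ← Real.exp_sub] at hcard
  rw [two_pow_eq_exp, ← Real.exp_add]
  refine hcard.trans_eq ?_
  ring_nf

lemma nonneg_of_pressure_lt [IsProbabilityMeasure P]
    (hPQ : ∀ a, 0 < cylProb Q a → 0 < cylProb P a) {t r : ℝ} (ht : 0 ≤ t)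
    (h : pressure P Q t < (r : EReal)) : 0 ≤ r := by
  obtain ⟨n, hn, hn0⟩ := ((eventually_pressureSum_le h).and (eventually_gt_atTop 0)).exists
  have hone : 1 ≤ pressureSum P Q t n := by
    rw [← sum_cylProb_filter hPQ n, pressureSum]
    refine Finset.sum_le_sum fun v hv => le_mul_of_one_le_left (cylProb_nonneg Q _) ?_
    exact Real.one_le_rpow_of_pos_of_le_one_of_nonpos (Finset.mem_filter.1 hv).2
      (cylProb_le_one P _) (neg_nonpos.2 ht)
  exact nonneg_of_mul_nonneg_left (Real.one_le_exp_iff.1 (hone.trans hn)) (Nat.cast_pos.2 hn0)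

end SumRpow

section Matches

variable [IsProbabilityMeasure P] [IsProbabilityMeasure Q]

lemma measure_prod_word_eq_word (hP : MeasurePreserving shift P P)
    (hQ : MeasurePreserving shift Q Q) (hPQ : ∀ a, 0 < cylProb Q a → 0 < cylProb P a)
    (r s n : ℕ) :
    P.prod Q {p : (ℕ → A) × (ℕ → A) | word p.1 r n = word p.2 s n} =
      ENNReal.ofReal (pressureSum P Q (-1) n) := by
  have hfiber (y : ℕ → A) : P ((fun x => (x, y)) ⁻¹'
      {p : (ℕ → A) × (ℕ → A) | word p.1 r n = word p.2 s n}) =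
        ENNReal.ofReal (cylProb P (word y s n)) := by
    have h := measure_word_eq hP r (word y s n)
    rw [length_word] at h
    rw [ofReal_cylProb, ← h]
    rfl
  rw [Measure.prod_apply_symm (measurableSet_word_eq_word r s n)]
  simp only [hfiber]
  rw [lintegral_word_eq hQ (fun a => ENNReal.ofReal (cylProb P a)), ← lintegral_cylProb_rpow hPQ]
  simp only [neg_neg, Real.rpow_one]

lemma Nondegenerate.ae_eventually_word_ne (hP : MeasurePreserving shift P P)
    (hQ : MeasurePreserving shift Q Q) (hPQ : ∀ a, 0 < cylProb Q a → 0 < cylProb P a)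
    (hND : Nondegenerate P Q) :
    ∃ C : ℕ, 1 ≤ C ∧ ∀ᵐ p : (ℕ → A) × (ℕ → A) ∂(P.prod Q), ∀ᶠ k : ℕ in atTop,
      ∀ r < 2 ^ (k + 1), ∀ s < 2 ^ (k + 1), word p.1 r (C * k) ≠ word p.2 s (C * k) := by
  obtain ⟨d, hd, hd0⟩ := EReal.lt_iff_exists_real_btwn.1 hND
  have hd0 : d < 0 := by exact_mod_cast hd0
  obtain ⟨C, hC⟩ := exists_nat_gt (4 / -d)
  have hC0 : 0 < C := Nat.cast_pos.1 ((div_pos four_pos (neg_pos.2 hd0)).trans hC)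
  rw [div_lt_iff₀ (neg_pos.2 hd0)] at hC
  refine ⟨C, hC0, ?_⟩
  have hmatch : ∀ᶠ k : ℕ in atTop,
      P.prod Q (⋃ r ∈ Finset.range (2 ^ (k + 1)), ⋃ s ∈ Finset.range (2 ^ (k + 1)),
        {p : (ℕ → A) × (ℕ → A) | word p.1 r (C * k) = word p.2 s (C * k)}) ≤
          ENNReal.ofReal (Real.exp (-1 * k)) := by
    filter_upwards [(tendsto_id.const_mul_atTop' hC0).eventually (eventually_pressureSum_le hd),
      eventually_ge_atTop 1] with k hk hk1
    refine (measure_biUnion_finset_le _ _).trans ((Finset.sum_le_sum fun r _ =>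
      (measure_biUnion_finset_le _ _).trans_eq (Finset.sum_congr rfl fun s _ =>
        measure_prod_word_eq_word hP hQ hPQ r s _)).trans ?_)
    rw [Finset.sum_const, Finset.sum_const, Finset.card_range, ← ENNReal.ofReal_nsmul,
      ← ENNReal.ofReal_nsmul, nsmul_eq_mul, nsmul_eq_mul]
    refine ENNReal.ofReal_le_ofReal ?_
    calc ((2 ^ (k + 1) : ℕ) : ℝ) * (((2 ^ (k + 1) : ℕ) : ℝ) * pressureSum P Q (-1) (C * k))
        ≤ ((2 ^ (k + 1) : ℕ) : ℝ) * (((2 ^ (k + 1) : ℕ) : ℝ) * Real.exp (d * (C * k : ℕ))) := by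
          gcongr
          exact hk
      _ = Real.exp (2 * Real.log 2 * (k + 1) + d * C * k) := by
          rw [Nat.cast_pow, Nat.cast_ofNat, two_pow_eq_exp, ← Real.exp_add, ← Real.exp_add]
          push_cast
          ring_nf
      _ ≤ Real.exp (-1 * k) := by
          gcongr
          have hk1 : (1 : ℝ) ≤ k := Nat.one_le_cast.2 hk1
          nlinarith [Real.log_two_lt_d9]
  filter_upwards [ae_eventually_notMem_of_summable (summable_exp_neg_mul zero_lt_one) hmatch]
    with p hp
  filter_upwards [hp] with k hk r hr s hs hrs
  simp only [Finset.mem_range, Set.mem_iUnion, not_exists] at hk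
  exact hk r hr s hs hrs

end Matches

end DyadicScale

section UpperBound

lemma tendsto_log_two_atTop : Tendsto (Nat.log 2) atTop atTop := by
  refine tendsto_atTop.2 fun b => ?_
  filter_upwards [eventually_ge_atTop (2 ^ b)] with N hN
  exact Nat.le_log_of_pow_le one_lt_two hN

lemma eventually_forall_le_div_of_isLittleO {τ : ℕ → ℕ}
    (hτ : (fun n => (τ n : ℝ)) =o[atTop] fun n : ℕ => (n : ℝ)) {C K : ℕ} (hC : 1 ≤ C)
    (hK : K ≠ 0) : ∀ᶠ k : ℕ in atTop, ∀ n ≤ C * k + 1, τ n ≤ k / K := by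
  have hC0 : (0 : ℝ) < C := Nat.cast_pos.2 hC
  have hK0 : (0 : ℝ) < K := Nat.cast_pos.2 (Nat.pos_of_ne_zero hK)
  have hlin : Tendsto (fun k : ℕ => C * k + 1) atTop atTop :=
    tendsto_atTop_mono (fun k => (Nat.le_mul_of_pos_left k hC).trans (Nat.le_succ _)) tendsto_id
  filter_upwards [hlin.eventually (eventually_forall_le_mul_of_isLittleO hτ
    (by positivity : 0 < 1 / (2 * C * K : ℝ))), eventually_ge_atTop 1] with k hk hk1 n hn
  rw [Nat.le_div_iff_mul_le (Nat.pos_of_ne_zero hK), ← Nat.cast_le (α := ℝ), Nat.cast_mul]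
  have hCk : ((C * k + 1 : ℕ) : ℝ) ≤ 2 * C * k := by
    have : C * k + 1 ≤ 2 * C * k := by nlinarith [Nat.mul_le_mul hC hk1]
    exact_mod_cast this
  calc (τ n : ℝ) * K ≤ 1 / (2 * C * K) * (2 * C * k) * K := by
        gcongr
        exact (hk n hn).trans (by gcongr)
    _ = k := by field_simp

variable {A : Type*} {τ : ℕ → ℕ} {m N : ℕ} {y x : ℕ → A}

/-- The numbers, counted from `0`, of the words of the parsing that are not the last one and are
followed by a word at least as long as the gap prescribed by `τ`. -/
noncomputable def gapFollowed (τ : ℕ → ℕ) (N : ℕ) (y x : ℕ → A) : Finset ℕ :=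
  {i ∈ Finset.range (parseCount N y x - 1) | τ (parseLength N y x i) ≤ parseLength N y x (i + 1)}

lemma gapFollowed_subset : gapFollowed τ N y x ⊆ Finset.range (parseCount N y x - 1) :=
  Finset.filter_subset _ _

lemma gapSeparated_of_subset_gapFollowed
    (hm : ∀ i, i + 1 < parseCount N y x → m < parseLength N y x i) {I : Finset ℕ}
    (hI : I ⊆ gapFollowed τ N y x) (hgap : ∀ i ∈ I, ∀ j ∈ I, i < j → i + 2 ≤ j) :
    GapSeparated τ m N I (parseEnd N y x) (parseLength N y x) := by
  intro i hi
  obtain ⟨hic, hτ⟩ := Finset.mem_filter.1 (hI hi)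
  rw [Finset.mem_range] at hic
  have hend := parseEnd_add_parseLength N y x i
  refine ⟨hm i (by omega), hend ▸ parseEnd_le N y x (i + 1), fun j hj hij => ?_⟩
  have hmono : parseEnd N y x (i + 1 + 1) ≤ parseEnd N y x j :=
    parseEnd_monotone N y x (hgap i hi j hj hij)
  have hnext := parseEnd_add_parseLength N y x (i + 1)
  omega

lemma card_sdiff_gapFollowed_le {b : ℕ} {Z : Finset ℕ}
    (hτ : ∀ i, i + 1 < parseCount N y x → τ (parseLength N y x i) ≤ b)
    (hZ : ∀ i, i + 1 < parseCount N y x → parseLength N y x i ≤ b → parseEnd N y x i ∈ Z) :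
    (Finset.range (parseCount N y x - 1) \ gapFollowed τ N y x).card ≤ Z.card + 1 := by
  set c := parseCount N y x with hc
  refine (Finset.card_le_card_of_injOn (fun i => parseEnd N y x (i + 1))
    (t := insert (parseEnd N y x (c - 1)) Z) (fun i hi => ?_) (fun i hi j hj hij => ?_)).trans
      (Finset.card_insert_le _ _)
  · simp only [gapFollowed, Finset.coe_sdiff, Set.mem_sdiff, Finset.mem_coe, Finset.mem_range,
      Finset.mem_filter, not_and, not_le, ← hc] at hi
    have hshort := (hi.2 hi.1).le.trans (hτ i (by omega))
    rcases eq_or_ne (i + 1) (c - 1) with hlast | hlast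
    · exact hlast ▸ Finset.mem_insert_self _ _
    · exact Finset.mem_insert_of_mem (hZ (i + 1) (by omega) hshort)
  · have hi := Finset.mem_range.1 (Finset.mem_sdiff.1 hi).1
    have hj := Finset.mem_range.1 (Finset.mem_sdiff.1 hj).1
    have := strictMonoOn_parseEnd.injOn (Set.mem_Iio.2 (by omega : i + 1 < c))
      (Set.mem_Iio.2 (by omega : j + 1 < c)) hij
    omega

/-- Keeping only every second word, the word in between serves as the gap. -/
lemma mul_sum_gapFollowed_le {w : List A → ℝ} {α r ε : ℝ} (hr : 0 ≤ r)
    (hm : ∀ i, i + 1 < parseCount N y x → m < parseLength N y x i)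
    (h : ∀ (I : Finset ℕ) (p l : ℕ → ℕ), GapSeparated τ m N I p l →
      α * ∑ i ∈ I, w (word y (p i) (l i)) ≤ r * ∑ i ∈ I, (l i : ℝ) + ε * N) :
    α * ∑ i ∈ gapFollowed τ N y x, w (parsedWord N y x i) ≤ r * N + 2 * (ε * N) := by
  have heven := h _ _ _ (gapSeparated_of_subset_gapFollowed hm
    (Finset.filter_subset Even (gapFollowed τ N y x)) fun i hi j hj hij => by
      have hi := Nat.even_iff.1 (Finset.mem_filter.1 hi).2
      have hj := Nat.even_iff.1 (Finset.mem_filter.1 hj).2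
      omega)
  have hodd := h _ _ _ (gapSeparated_of_subset_gapFollowed hm
    (Finset.filter_subset (¬ Even ·) (gapFollowed τ N y x)) fun i hi j hj hij => by
      have hi := Nat.not_even_iff.1 (Finset.mem_filter.1 hi).2
      have hj := Nat.not_even_iff.1 (Finset.mem_filter.1 hj).2
      omega)
  have hlength : ∑ i ∈ gapFollowed τ N y x, (parseLength N y x i : ℝ) ≤ N := by
    have hsub := Finset.sum_le_sum_of_subset (f := parseLength N y x)
      (gapFollowed_subset (τ := τ) (N := N) (y := y) (x := x))
    rw [sum_parseLength] at hsub
    exact_mod_cast hsub.trans (parseEnd_le N y x _)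
  simp only [parsedWord_eq]
  rw [← Finset.sum_filter_add_sum_filter_not _ Even] at hlength ⊢
  linarith [mul_le_mul_of_nonneg_left hlength hr]

variable [MeasurableSpace A] [MeasurableSingletonClass A] [Fintype A] {P Q : Measure (ℕ → A)}
  [IsProbabilityMeasure P] [IsProbabilityMeasure Q]

lemma ae_eventually_sum_gapFollowed_le (hP : MeasurePreserving shift P P)
    (hQ : MeasurePreserving shift Q Q) (hPQ : ∀ a, 0 < cylProb Q a → 0 < cylProb P a)
    (hSLD : SelectivelyLowerDecoupled P) {u : ℕ → ℝ} (hdec : GapDecoupled Q u τ)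
    (hu : u =o[atTop] fun n : ℕ => (n : ℝ)) {t R ε : ℝ} (ht : 0 < t) (hR : 0 ≤ R)
    (h : pressure P Q t < ((t * R : ℝ) : EReal)) (hε : 0 < ε) :
    ∀ᵐ p : (ℕ → A) × (ℕ → A) ∂(P.prod Q), ∀ᶠ N : ℕ in atTop,
      ∑ i ∈ gapFollowed τ N p.2 p.1, -Real.log (cylProb P (parsedWord N p.2 p.1 i)) ≤
        (R + ε) * N := by
  obtain ⟨m, hm⟩ := hdec.ae_eventually_mul_sum_neg_log_le hQ hPQ hu h (mul_pos ht (half_pos hε))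
  filter_upwards [ae_eventually_lt_parseLength hP hQ hPQ hSLD,
    Measure.quasiMeasurePreserving_snd.ae hm] with p hlen hsum
  filter_upwards [hlen m, hsum] with N hlenN hsumN
  have hle := mul_sum_gapFollowed_le (w := fun a => -Real.log (cylProb P a)) (by positivity)
    hlenN hsumN
  refine le_of_mul_le_mul_left (hle.trans_eq ?_) ht
  ring

lemma Nondegenerate.exists_ae_eventually_parseLength_le (hP : MeasurePreserving shift P P)
    (hQ : MeasurePreserving shift Q Q) (hPQ : ∀ a, 0 < cylProb Q a → 0 < cylProb P a)
    (hND : Nondegenerate P Q) :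
    ∃ C : ℕ, 1 ≤ C ∧ ∀ᵐ p : (ℕ → A) × (ℕ → A) ∂(P.prod Q), ∀ᶠ N : ℕ in atTop,
      ∀ i, i + 1 < parseCount N p.2 p.1 → parseLength N p.2 p.1 i ≤ C * Nat.log 2 N + 1 := by
  obtain ⟨C, hC, hne⟩ := hND.ae_eventually_word_ne hP hQ hPQ
  refine ⟨C, hC, ?_⟩
  filter_upwards [hne] with p hp
  filter_upwards [tendsto_log_two_atTop.eventually (hp.and (eventually_ge_atTop 2))]
    with N ⟨hpN, hk⟩ i hi
  have hN : N < 2 ^ (Nat.log 2 N + 1) := Nat.lt_pow_succ_log_self one_lt_two N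
  exact parseLength_le_succ hi (hk.trans (Nat.le_mul_of_pos_left _ hC))
    fun r hr s hs => hpN r (hr.trans hN) s (hs.trans hN)

lemma exists_ae_eventually_neg_log_parsedWord_le (hP : MeasurePreserving shift P P)
    (hQ : MeasurePreserving shift Q Q) (hPQ : ∀ a, 0 < cylProb Q a → 0 < cylProb P a)
    (hND : Nondegenerate P Q) {t r : ℝ} (ht : 0 < t) (h : pressure P Q t < (r : EReal)) :
    ∃ B : ℝ, 0 < B ∧ ∀ᵐ p : (ℕ → A) × (ℕ → A) ∂(P.prod Q), ∀ᶠ N : ℕ in atTop,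
      ∀ i, i + 1 < parseCount N p.2 p.1 →
        -Real.log (cylProb P (parsedWord N p.2 p.1 i)) ≤ B * Nat.log 2 N := by
  obtain ⟨C, hC, hlen⟩ := hND.exists_ae_eventually_parseLength_le hP hQ hPQ
  obtain ⟨B, hB, hlog⟩ := exists_ae_eventually_neg_log_le hQ hPQ ht h hC
  refine ⟨B, hB, ?_⟩
  filter_upwards [hlen, Measure.quasiMeasurePreserving_snd.ae hlog,
    Measure.quasiMeasurePreserving_snd.ae (ae_cylProb_word_pos hQ hPQ)] with p hlen hlog hpos
  filter_upwards [hlen, tendsto_log_two_atTop.eventually hlog] with N hlenN hlogN i hi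
  refine le_trans ?_ (hlogN _ ((parseEnd_lt (Nat.lt_of_succ_lt hi)).trans
    (Nat.lt_pow_succ_log_self one_lt_two N)))
  rw [parsedWord_eq]
  exact neg_le_neg (Real.log_le_log (hpos _ _) (cylProb_word_anti P p.2 _ (hlenN i hi)))

/-- A short word of the parsing starts at an improbable word, since probable words occur. -/
lemma ae_eventually_card_sdiff_gapFollowed_le (hP : MeasurePreserving shift P P)
    (hQ : MeasurePreserving shift Q Q) (hPQ : ∀ a, 0 < cylProb Q a → 0 < cylProb P a)
    (hSLD : SelectivelyLowerDecoupled P) (hND : Nondegenerate P Q)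
    (hτ : (fun n => (τ n : ℝ)) =o[atTop] fun n : ℕ => (n : ℝ)) {t R : ℝ} (ht : 0 < t)
    (hR : 0 ≤ R) (h : pressure P Q t < ((t * R : ℝ) : EReal)) :
    ∀ᵐ p : (ℕ → A) × (ℕ → A) ∂(P.prod Q), ∀ᶠ N : ℕ in atTop,
      ((Finset.range (parseCount N p.2 p.1 - 1) \ gapFollowed τ N p.2 p.1).card : ℝ) ≤
        N * Real.exp (-(t / 16) * Nat.log 2 N) + 1 := by
  obtain ⟨K, hK⟩ := exists_nat_ge (32 * R + 1)
  have hK0 : K ≠ 0 := by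
    rintro rfl
    linarith [Nat.cast_zero (R := ℝ)]
  have hscale : ∀ᶠ k in atTop, 1 ≤ k / K ∧ k / K ≤ k := by
    filter_upwards [(Nat.tendsto_div_const_atTop hK0).eventually_ge_atTop 1] with k hk
    exact ⟨hk, Nat.div_le_self k K⟩
  obtain ⟨C, hC, hlen⟩ := hND.exists_ae_eventually_parseLength_le hP hQ hPQ
  filter_upwards [hlen, Measure.quasiMeasurePreserving_fst.ae (hSLD.ae_eventually_occurs hP hscale),
    Measure.quasiMeasurePreserving_snd.ae
      (ae_eventually_card_improbable_le hQ hPQ ht hR h hK0 (by linarith))] with p hlen hocc hfew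
  filter_upwards [hlen, tendsto_log_two_atTop.eventually (hocc.and (hfew.and
    (eventually_forall_le_div_of_isLittleO hτ hC hK0))), eventually_ne_atTop 0]
    with N hlenN ⟨hoccN, hfewN, hτN⟩ hN
  set k := Nat.log 2 N
  have hkN : 2 ^ k ≤ N := Nat.pow_log_le_self 2 hN
  have himprobable : ∀ i, i + 1 < parseCount N p.2 p.1 → parseLength N p.2 p.1 i ≤ k / K →
      cylProb P (word p.2 (parseEnd N p.2 p.1 i) (k / K)) < Real.exp (-(k / 8)) := by
    intro i hi hshort
    by_contra! hprobable
    obtain ⟨r, hr, hw⟩ := hoccN _ (length_word _ _ _) hprobable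
    rw [length_word] at hr hw
    exact word_ne_of_parseLength_le hi hshort (hr.trans hkN) hw
  have hcard := card_sdiff_gapFollowed_le
    (Z := (Finset.range (2 ^ (k + 1))).filter fun i =>
      cylProb P (word p.2 i (k / K)) < Real.exp (-(k / 8)))
    (fun i hi => hτN _ (hlenN i hi)) fun i hi hshort =>
    Finset.mem_filter.2 ⟨Finset.mem_range.2 ((parseEnd_lt (Nat.lt_of_succ_lt hi)).trans
      (Nat.lt_pow_succ_log_self one_lt_two N)), himprobable i hi hshort⟩
  have hcard' := Nat.cast_le (α := ℝ).2 hcard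
  rw [Nat.cast_succ] at hcard'
  refine hcard'.trans (add_le_add_left (hfewN.trans ?_) 1)
  gcongr
  exact_mod_cast hkN

lemma ae_eventually_sum_sdiff_gapFollowed_le (hP : MeasurePreserving shift P P)
    (hQ : MeasurePreserving shift Q Q) (hPQ : ∀ a, 0 < cylProb Q a → 0 < cylProb P a)
    (hSLD : SelectivelyLowerDecoupled P) (hND : Nondegenerate P Q)
    (hτ : (fun n => (τ n : ℝ)) =o[atTop] fun n : ℕ => (n : ℝ)) {t R ε : ℝ} (ht : 0 < t)
    (hR : 0 ≤ R) (h : pressure P Q t < ((t * R : ℝ) : EReal)) (hε : 0 < ε) :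
    ∀ᵐ p : (ℕ → A) × (ℕ → A) ∂(P.prod Q), ∀ᶠ N : ℕ in atTop,
      ∑ i ∈ Finset.range (parseCount N p.2 p.1 - 1) \ gapFollowed τ N p.2 p.1,
        -Real.log (cylProb P (parsedWord N p.2 p.1 i)) ≤ ε * N := by
  obtain ⟨B, hB, hlog⟩ := exists_ae_eventually_neg_log_parsedWord_le hP hQ hPQ hND ht h
  filter_upwards [hlog, ae_eventually_card_sdiff_gapFollowed_le hP hQ hPQ hSLD hND hτ ht hR h]
    with p hlog hcard
  filter_upwards [hlog, hcard, eventually_ne_atTop 0,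
    tendsto_log_two_atTop.eventually ((eventually_mul_le_exp (by positivity : 0 < t / 16)
      (2 * B / ε)).and (eventually_mul_le_exp (by norm_num : (0 : ℝ) < 1 / 2) (2 * B / ε)))]
    with N hlogN hcardN hN ⟨hexp, hhalf⟩
  set k := Nat.log 2 N
  have hkN : (2 : ℝ) ^ k ≤ N := by exact_mod_cast Nat.pow_log_le_self 2 hN
  have hBexp : B * k ≤ ε / 2 * Real.exp (t / 16 * k) := by
    rw [div_mul_eq_mul_div, div_le_iff₀ hε] at hexp
    linarith
  have hBN : B * k ≤ ε / 2 * N := by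
    rw [div_mul_eq_mul_div, div_le_iff₀ hε] at hhalf
    linarith [mul_le_mul_of_nonneg_right ((exp_half_mul_le_two_pow k).trans hkN) hε.le]
  calc ∑ i ∈ Finset.range (parseCount N p.2 p.1 - 1) \ gapFollowed τ N p.2 p.1,
        -Real.log (cylProb P (parsedWord N p.2 p.1 i))
      ≤ (Finset.range (parseCount N p.2 p.1 - 1) \ gapFollowed τ N p.2 p.1).card * (B * k) := by
        rw [← nsmul_eq_mul]
        refine Finset.sum_le_card_nsmul _ _ _ fun i hi => hlogN i ?_
        have := Finset.mem_range.1 (Finset.mem_sdiff.1 hi).1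
        omega
    _ ≤ (N * Real.exp (-(t / 16) * k) + 1) * (B * k) := by gcongr
    _ = N * Real.exp (-(t / 16) * k) * (B * k) + B * k := by ring
    _ ≤ N * Real.exp (-(t / 16) * k) * (ε / 2 * Real.exp (t / 16 * k)) + ε / 2 * N := by gcongr
    _ = ε * N := by
        rw [neg_mul, Real.exp_neg]
        field_simp
        ring

theorem ae_eventually_average_parsedWord_le (hP : MeasurePreserving shift P P)
    (hQ : MeasurePreserving shift Q Q) (hPQ : ∀ a, 0 < cylProb Q a → 0 < cylProb P a)
    (hSLD : SelectivelyLowerDecoupled P) (hUD : UpperDecoupled Q) (hND : Nondegenerate P Q) {R : ℝ}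
    (hR : sInf (pressureSlope P Q '' Set.Ioi 0) < (R : EReal)) :
    ∀ᵐ p : (ℕ → A) × (ℕ → A) ∂(P.prod Q), ∀ᶠ N : ℕ in atTop,
      1 / (N : ℝ) * ∑ i ∈ Finset.range (parseCount N p.2 p.1 - 1),
        -Real.log (cylProb P (parsedWord N p.2 p.1 i)) ≤ R := by
  obtain ⟨R₀, hR₀, hR₀R⟩ := EReal.lt_iff_exists_real_btwn.1 hR
  have hε : 0 < (R - R₀) / 2 := half_pos (sub_pos.2 (EReal.coe_lt_coe_iff.1 hR₀R))
  obtain ⟨t, ht, hpressure⟩ := exists_pressure_lt_of_sInf_lt hR₀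
  have hR₀0 : 0 ≤ R₀ := nonneg_of_mul_nonneg_right (nonneg_of_pressure_lt hPQ ht.le hpressure) ht
  obtain ⟨u, τ, hu, hτ, hdec⟩ := hUD.exists_gapDecoupled hQ
  filter_upwards [ae_eventually_sum_gapFollowed_le hP hQ hPQ hSLD hdec hu ht hR₀0 hpressure hε,
    ae_eventually_sum_sdiff_gapFollowed_le hP hQ hPQ hSLD hND hτ ht hR₀0 hpressure hε]
    with p hheavy hlight
  filter_upwards [hheavy, hlight, eventually_gt_atTop 0] with N hheavyN hlightN hN
  rw [one_div, inv_mul_le_iff₀ (Nat.cast_pos.2 hN), ← Finset.sum_sdiff gapFollowed_subset]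
  linarith

end UpperBound

section AlmostSureLimits

variable {Ω : Type*} [MeasurableSpace Ω] {μ : Measure Ω} {f : Ω → ℕ → ℝ} {D : EReal}

lemma ae_le_liminf (h : ∀ R : ℝ, (R : EReal) < D → ∀ᵐ ω ∂μ, ∀ᶠ N in atTop, R ≤ f ω N) :
    ∀ᵐ ω ∂μ, D ≤ liminf (fun N => (f ω N : EReal)) atTop := by
  have hrat : ∀ᵐ ω ∂μ, ∀ q : ℚ, ((q : ℝ) : EReal) < D → ∀ᶠ N in atTop, (q : ℝ) ≤ f ω N :=
    ae_all_iff.2 fun q => eventually_imp_distrib_left.2 (h q)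
  filter_upwards [hrat] with ω hω
  refine le_of_forall_lt fun d hd => ?_
  obtain ⟨q, hdq, hq⟩ := EReal.lt_iff_exists_rat_btwn.1 hd
  exact hdq.trans_le (le_liminf_of_le (by isBoundedDefault)
    ((hω q hq).mono fun N hN => EReal.coe_le_coe_iff.2 hN))

lemma ae_limsup_le (h : ∀ R : ℝ, D < (R : EReal) → ∀ᵐ ω ∂μ, ∀ᶠ N in atTop, f ω N ≤ R) :
    ∀ᵐ ω ∂μ, limsup (fun N => (f ω N : EReal)) atTop ≤ D := by
  have hrat : ∀ᵐ ω ∂μ, ∀ q : ℚ, D < ((q : ℝ) : EReal) → ∀ᶠ N in atTop, f ω N ≤ (q : ℝ) :=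
    ae_all_iff.2 fun q => eventually_imp_distrib_left.2 (h q)
  filter_upwards [hrat] with ω hω
  refine le_of_forall_gt fun d hd => ?_
  obtain ⟨q, hq, hqd⟩ := EReal.lt_iff_exists_rat_btwn.1 hd
  exact (limsup_le_of_le (by isBoundedDefault)
    ((hω q hq).mono fun N hN => EReal.coe_le_coe_iff.2 hN)).trans_lt hqd

end AlmostSureLimits

end ZivMerhav

theorem proposition3p5_general {A : Type*} [Fintype A] [MeasurableSpace A]
    [MeasurableSingletonClass A] (P Q : Measure (ℕ → A)) [IsProbabilityMeasure P]
    [IsProbabilityMeasure Q] (hP : MeasurePreserving ZivMerhav.shift P P)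
    (hQ : MeasurePreserving ZivMerhav.shift Q Q)
    (hsupp : ZivMerhav.seqSupport Q ⊆ ZivMerhav.seqSupport P)
    (hSLD : ZivMerhav.SelectivelyLowerDecoupled P)
    (hUD : ZivMerhav.UpperDecoupled Q) (hND : ZivMerhav.Nondegenerate P Q) :
    ∃ Dminus Dplus : EReal,
      ZivMerhav.HasLeftDeriv (ZivMerhav.pressure P Q) 0 Dminus ∧
      ZivMerhav.HasRightDeriv (ZivMerhav.pressure P Q) 0 Dplus ∧
      ∀ᵐ p : (ℕ → A) × (ℕ → A) ∂(P.prod Q),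
        Dminus ≤ liminf (fun N : ℕ =>
          ((1 / ((N : ℝ) - (ZivMerhav.parseCount N p.2 p.1 : ℝ)) *
            ∑ i ∈ Finset.range (ZivMerhav.parseCount N p.2 p.1),
              -Real.log (ZivMerhav.cylProb P (ZivMerhav.trimmedWord N p.2 p.1 i)) : ℝ) : EReal))
          atTop ∧
        limsup (fun N : ℕ =>
          ((1 / (N : ℝ) *
            ∑ i ∈ Finset.range (ZivMerhav.parseCount N p.2 p.1 - 1),
              -Real.log (ZivMerhav.cylProb P (ZivMerhav.parsedWord N p.2 p.1 i)) : ℝ) : EReal))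
          atTop ≤ Dplus := by
  have hPQ : ∀ a, 0 < ZivMerhav.cylProb Q a → 0 < ZivMerhav.cylProb P a := fun _ ha =>
    ZivMerhav.cylProb_pos_of_seqSupport_subset hsupp ha
  refine ⟨_, _, ZivMerhav.hasLeftDeriv_pressure hPQ, ZivMerhav.hasRightDeriv_pressure hPQ, ?_⟩
  filter_upwards [
    ZivMerhav.ae_le_liminf fun _ hR =>
      ZivMerhav.ae_eventually_le_average_trimmedWord hP hQ hPQ hSLD hUD hR,
    ZivMerhav.ae_limsup_le fun _ hR =>
      ZivMerhav.ae_eventually_average_parsedWord_le hP hQ hPQ hSLD hUD hND hR]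
    with p hlower hupper
  exact ⟨hlower, hupper⟩

theorem proposition3p5 {A : Type*} [Fintype A] [MeasurableSpace A] [MeasurableSingletonClass A]
    (P Q : Measure (ℕ → A)) [IsProbabilityMeasure P] [IsProbabilityMeasure Q]
    (hP : MeasurePreserving ZivMerhav.shift P P) (hQ : MeasurePreserving ZivMerhav.shift Q Q)
    (hsupp : ZivMerhav.seqSupport Q ⊆ ZivMerhav.seqSupport P)
    (hSLD : ZivMerhav.SelectivelyLowerDecoupled P) (hSE : ZivMerhav.DecaysSlowlyEnough P)
    (hUD : ZivMerhav.UpperDecoupled Q) (hND : ZivMerhav.Nondegenerate P Q) :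
    ∃ Dminus Dplus : EReal,
      ZivMerhav.HasLeftDeriv (ZivMerhav.pressure P Q) 0 Dminus ∧
      ZivMerhav.HasRightDeriv (ZivMerhav.pressure P Q) 0 Dplus ∧
      ∀ᵐ p : (ℕ → A) × (ℕ → A) ∂(P.prod Q),
        Dminus ≤ liminf (fun N : ℕ =>
          ((1 / ((N : ℝ) - (ZivMerhav.parseCount N p.2 p.1 : ℝ)) *
            ∑ i ∈ Finset.range (ZivMerhav.parseCount N p.2 p.1),
              -Real.log (ZivMerhav.cylProb P (ZivMerhav.trimmedWord N p.2 p.1 i)) : ℝ) : EReal))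
          atTop ∧
        limsup (fun N : ℕ =>
          ((1 / (N : ℝ) *
            ∑ i ∈ Finset.range (ZivMerhav.parseCount N p.2 p.1 - 1),
              -Real.log (ZivMerhav.cylProb P (ZivMerhav.parsedWord N p.2 p.1 i)) : ℝ) : EReal))
          atTop ≤ Dplus :=
  proposition3p5_general P Q hP hQ hsupp hSLD hUD hND
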